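/- **Model.** A circuit is a finite acyclic set of binary gates, each executing one $+$ or one $\times$, with constants $0,1,-1$, arranged in time steps so that a gate uses only inputs, constants and gates of earlier time steps; all gates of one time step run simultaneously, one processor per gate. Its depth is the number of time steps and its size the number of gates, which bounds the number of processors. Over a commutative ring this is a division-free arithmetic circuit; over bits, where $+$ is XOR and $\times$ is AND, it is a circuit of bitwise operations (shifts are wirings). **Algorithm.** The input is a simple graph $\overline G=(\overline V,\overline E)$ with $|\overline V|=n$ even, weights $w:\overline E\to\mathbb Z$, a perturbation range $W_{\max}\ge 1$, and a sample of the perturbation $W:\overline E\to\{1,\dots,W_{\max}\}$; a truncation threshold $w_{\mathrm{th}}\ge 1$ is fixed. The algorithm works over $R=\mathbb F_2[X]/(X^{w_{\mathrm{th}}})$, whose elements are bit strings of length $w_{\mathrm{th}}$, and $\deg_{\min}(f)$ is the smallest exponent occurring in $f\in R$, with $\deg_{\min}(0)=0$. 1. $\tilde w(e)=\tilde C\,w(e)+W(e)$ with $\tilde C=\frac n2(W_{\max}-1)+1$. 2. $B_{i,j}=X^{\tilde w(\{i,j\})}$ if $\{i,j\}\in\overline E$ and $B_{i,j}=0$ otherwise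 (for $\tilde w\ge 0$). 3. Compute $\det B$ and $w^*=\lfloor\deg_{\min}(\det B)/2\rfloor$. 4. Compute the minors $M_{i,j}=\det B^{(i,j)}$, where $B^{(i,j)}$ is $B$ without row $i$ and column $j$. If $w^*=0$, output failure; otherwise output $M=\{\{i,j\}\in\overline E:\deg_{\min}(M_{i,j}X^{\tilde w(\{i,j\})})=2w^*\}$. The Samuelson–Berkowitz algorithm on an $m\times m$ matrix has two phases. First, for $0\le t<m$, write the leading principal submatrix of size $t+1$ as $\begin{pmatrix}M&S\\ r&\alpha\end{pmatrix}$ with $M$ of size $t\times t$, and compute $1,-\alpha,-rS,-rMS,-rM^2S,\dots$; these are the entries of the first column of a $(t+2)\times(t+1)$ lower triangular Toeplitz matrix $T_t$. Second, compute $T_{m-1}\cdots T_1T_0$; the result is $(-1)^m$ times the last entry of this column. **Theorem (Parallelizability).** Every step of this algorithm runs in parallel depth $O(\operatorname{polylog}(|\overline V|,W_{\max}))$ with $\operatorname{poly}(|\overline V|,W_{\max})$ processors, using only bitwise operations, if $w_{\mathrm{th}}$ and the bit length of the weights are polynomially bounded in $|\overline V|$ and $W_{\max}$; the determinant and all minors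 are computed over $R$ by the division-free Samuelson–Berkowitz algorithm. Precisely, the Samuelson–Berkowitz algorithm computes the determinant over every commutative ring, and for every $a\in\mathbb N$ there is a constant $c$ such that the following holds for every $n$. (i) Each of the two phases of the Samuelson–Berkowitz algorithm, for an $n\times n$ matrix, and likewise for all its submatrices without one row and one column at once, is executed over every commutative ring by a division-free arithmetic circuit, depending only on $n$ and $a$, of depth at most $c\lfloor\log_2 (n+2)\rfloor^c$ and size at most $c(n+2)^c$. (ii) Let $N=n+W_{\max}+2$, with $n$ even and $W_{\max},w_{\mathrm{th}}\ge 1$, let $w_{\mathrm{th}},b\le N^a$, and let the weights satisfy $-2^b\le w(e)<2^b$. Each of the following is done by a circuit of bitwise operations, depending only on $a,n,W_{\max},w_{\mathrm{th}},b$, of depth at most $c\lfloor\log_2 N\rfloor^c$ and size at most $cN^c$: computing $\tilde w$ from $(\overline G,w,W)$; computing $B$ from $(\overline G,\tilde w)$; executing over $R$, gate by gate, each of the arithmetic circuits of (i), which yields the determinant in step 3 and all minors in step 4; computing $w^*$ from the determinant; computing the output (failure or $M$) from $\overline G$, $\tilde w$, the minors and $w^*$; and the whole algorithm, from $(\overline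 G,w,W)$ to its output, whenever $\tilde w\ge 0$. -/

import Mathlib

open Polynomial

noncomputable section

namespace MWPM

/-! ### Circuits

A circuit is a finite set of binary gates, each executing one addition or one multiplication.  Its
gates carry a time step; a gate may only use inputs, constants and gates of strictly earlier time
steps, so all gates of one time step run simultaneously, one processor per gate.  Fan-out is
unbounded.  A circuit can be run over any commutative ring: over an arbitrary ring it is a
division-free arithmetic circuit, over `Bool` (where addition is XOR and multiplication is AND) it
is a circuit of bit operations. -/

/-- The two kinds of gates. -/
inductive Op
  | add
  | mul

/-- A wire: a constant, an input or the result of a gate. -/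
inductive Wire (ι γ : Type)
  | zero
  | one
  | negOne
  | input (i : ι)
  | gate (g : γ)

/-- The result of a gate on given operands. -/
def Op.run {R : Type*} [CommRing R] : Op → R → R → R
  | .add, a, b => a + b
  | .mul, a, b => a * b

/-- The value on a wire, given the inputs and the results of the gates. -/
def Wire.val {R : Type*} [CommRing R] {ι γ : Type} (x : ι → R) (v : γ → R) : Wire ι γ → R
  | .zero => 0
  | .one => 1
  | .negOne => -1
  | .input i => x i
  | .gate g => v g

/-- A circuit with inputs indexed by `ι` and outputs indexed by `o`. -/
structure Circuit (ι o : Type) where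
  /-- the gates -/
  Gate : Type
  /-- there are finitely many gates -/
  [finite : Fintype Gate]
  /-- the operation that a gate executes -/
  op : Gate → Op
  /-- the first operand of a gate -/
  left : Gate → Wire ι Gate
  /-- the second operand of a gate -/
  right : Gate → Wire ι Gate
  /-- the time step at which a gate is executed -/
  time : Gate → ℕ
  left_lt : ∀ g h, left g = .gate h → time h < time g
  right_lt : ∀ g h, right g = .gate h → time h < time g
  /-- the wires on which the outputs are read -/
  out : o → Wire ι Gate

namespace Circuit

variable {ι o : Type} {R : Type*} [CommRing R]

/-- The result of a gate on the input `x`. -/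
def gateVal (C : Circuit ι o) (x : ι → R) (g : C.Gate) : R :=
  (C.op g).run
    (match hl : C.left g with
      | .zero => 0
      | .one => 1
      | .negOne => -1
      | .input i => x i
      | .gate h => gateVal C x h)
    (match hr : C.right g with
      | .zero => 0
      | .one => 1
      | .negOne => -1
      | .input i => x i
      | .gate h => gateVal C x h)
termination_by C.time g
decreasing_by
  · exact C.left_lt g h hl
  · exact C.right_lt g h hr

/-- The value of a wire of the circuit on the input `x`. -/
def wireVal (C : Circuit ι o) (x : ι → R) (u : Wire ι C.Gate) : R := u.val x (C.gateVal x)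

theorem gateVal_eq (C : Circuit ι o) (x : ι → R) (g : C.Gate) :
    C.gateVal x g = (C.op g).run (C.wireVal x (C.left g)) (C.wireVal x (C.right g)) := by
  rw [gateVal]
  congr 1
  · split <;> simp_all [wireVal, Wire.val]
  · split <;> simp_all [wireVal, Wire.val]

/-- The outputs of the circuit on the input `x`. -/
def eval (C : Circuit ι o) (x : ι → R) (k : o) : R := C.wireVal x (C.out k)

/-- The number of gates; it bounds the number of processors. -/
def size (C : Circuit ι o) : ℕ := @Fintype.card C.Gate C.finite

/-- The number of parallel time steps. -/
def depth (C : Circuit ι o) : ℕ := (@Finset.univ C.Gate C.finite).sup fun g => C.time g + 1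

/-- `C` has depth at most `c * (log N) ^ c` and at most `c * N ^ c` gates. -/
def Polylog (C : Circuit ι o) (c N : ℕ) : Prop :=
  C.depth ≤ c * Nat.log 2 N ^ c ∧ C.size ≤ c * N ^ c

end Circuit

/-- Over `Bool` the gates are the bit operations XOR and AND. -/
theorem run_bool (a b : Bool) :
    Op.add.run a b = Bool.xor a b ∧ Op.mul.run a b = Bool.and a b := ⟨rfl, rfl⟩

/-- Over `Bool` the constant wires carry the bits `0`, `1` and `1`. -/
theorem const_bool {ι γ : Type} (x : ι → Bool) (v : γ → Bool) :
    (Wire.zero : Wire ι γ).val x v = false ∧ (Wire.one : Wire ι γ).val x v = true ∧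
      (Wire.negOne : Wire ι γ).val x v = true := ⟨rfl, rfl, rfl⟩

/-! ### The truncated polynomial ring -/

/-- The ring `𝔽₂[X]/(X ^ d)`. -/
abbrev Trunc (d : ℕ) : Type := AdjoinRoot ((X : (ZMod 2)[X]) ^ d)

/-- The class of `X`. -/
def Trunc.X (d : ℕ) : Trunc d := AdjoinRoot.root ((Polynomial.X : (ZMod 2)[X]) ^ d)

/-- The coefficient of `X ^ k` in the representative of degree less than `d`. -/
def Trunc.coeff {d : ℕ} (p : Trunc d) (k : ℕ) : ZMod 2 :=
  (AdjoinRoot.modByMonicHom (monic_X_pow d) p).coeff k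

/-- The bit string of length `d` that represents an element. -/
def Trunc.bit {d : ℕ} (p : Trunc d) (k : Fin d) : Bool := decide (p.coeff k = 1)

/-- The smallest exponent that occurs, with value `0` at the zero polynomial. -/
def Trunc.degMin {d : ℕ} (p : Trunc d) : ℕ := sInf {k | p.coeff k ≠ 0}

/-- The bits of a family of ring elements. -/
def bits {d : ℕ} {ι : Type} (x : ι → Trunc d) : ι × Fin d → Bool := fun p => (x p.1).bit p.2

/-- The bit circuit `Q` executes the arithmetic circuit `P` gate by gate over `𝔽₂[X]/(X ^ d)`:
the bit string of the result of every gate of `P` is present on wires of `Q`, and `Q` outputs the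
bit strings of the outputs of `P`. -/
def Realizes {ι o : Type} (d : ℕ) (Q : Circuit (ι × Fin d) (o × Fin d)) (P : Circuit ι o) : Prop :=
  ∃ block : P.Gate → Fin d → Wire (ι × Fin d) Q.Gate, ∀ x : ι → Trunc d,
    (∀ g k, Q.wireVal (bits x) (block g k) = (P.gateVal x g).bit k) ∧
    Q.eval (bits x) = bits (P.eval x)

/-! ### The Samuelson–Berkowitz algorithm -/

section SamuelsonBerkowitz

variable {R : Type*} [CommRing R] {m : ℕ}

/-- The leading principal `t × t` submatrix. -/
def leading (A : Matrix (Fin m) (Fin m) R) (t : Fin m) : Matrix (Fin t) (Fin t) R :=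
  A.submatrix (Fin.castLE t.2.le) (Fin.castLE t.2.le)

/-- First phase.  Write the leading principal submatrix of size `t + 1` as `[[M, S], [r, a]]`, with
`M` of size `t × t` and `a` a scalar; the entries are `1, -a, -(r S), -(r M S), -(r M² S), …`. -/
def sbCoeff (A : Matrix (Fin m) (Fin m) R) (t : Fin m) : ℕ → R
  | 0 => 1
  | 1 => -A t t
  | j + 2 => -((fun k => A t (Fin.castLE t.2.le k)) ⬝ᵥ
      ((leading A t ^ j).mulVec fun k => A (Fin.castLE t.2.le k) t))

/-- The `(t + 2) × (t + 1)` lower triangular Toeplitz matrix with entries `q t (i - j)`, padded by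
zeros to size `(m + 1) × (m + 1)`. -/
def toeplitz (q : Fin m → Fin (m + 1) → R) (t : Fin m) :
    Matrix (Fin (m + 1)) (Fin (m + 1)) R :=
  fun i j => if j ≤ i ∧ (j : ℕ) ≤ t ∧ (i : ℕ) ≤ t + 1 then q t (i - j) else 0

/-- Second phase: up to sign, the last entry of the first column of the product of the Toeplitz
matrices, the factor of largest index standing first. -/
def sbProduct (q : Fin m → Fin (m + 1) → R) : R :=
  (-1) ^ m * (List.ofFn fun t : Fin m => toeplitz q t.rev).prod (Fin.last m) 0

/-- The result of the Samuelson–Berkowitz algorithm. -/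
def sbDet (A : Matrix (Fin m) (Fin m) R) : R := sbProduct fun t j => sbCoeff A t j

end SamuelsonBerkowitz

/-- The arithmetic circuit `P` executes the first phase on the family of `m × m` matrices
`(r, c) ↦ x (sub k r c)`, for `k : κ`, over every commutative ring. -/
def ExecutesPhase₁ {ι κ : Type} {m : ℕ} (P : Circuit ι (κ × Fin m × Fin (m + 1)))
    (sub : κ → Fin m → Fin m → ι) : Prop :=
  ∀ (R : Type) [CommRing R] (x : ι → R) (k : κ) (t : Fin m) (j : Fin (m + 1)),
    P.eval x (k, t, j) = sbCoeff (Matrix.of fun r c => x (sub k r c)) t j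

/-- The arithmetic circuit `P` executes the second phase on a family, indexed by `κ`, of results of
the first phase, over every commutative ring. -/
def ExecutesPhase₂ {κ : Type} {m : ℕ} (P : Circuit (κ × Fin m × Fin (m + 1)) κ) : Prop :=
  ∀ (R : Type) [CommRing R] (q : κ × Fin m × Fin (m + 1) → R) (k : κ),
    P.eval q k = sbProduct fun t j => q (k, t, j)

/-! ### The decoding algorithm -/

/-- The indices of an `(n - 1)`-element list from which the `i`-th entry has been removed. -/
def skip {n : ℕ} (i : Fin n) (r : Fin (n - 1)) : Fin n :=
  ⟨if (r : ℕ) < i then r else r + 1, by split <;> omega⟩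

/-- The submatrix without the `i`-th row and the `j`-th column. -/
def removed {n : ℕ} {R : Type*} (B : Matrix (Fin n) (Fin n) R) (i j : Fin n) :
    Matrix (Fin (n - 1)) (Fin (n - 1)) R := B.submatrix (skip i) (skip j)

section Algorithm

variable {n : ℕ} (G : SimpleGraph (Fin n))

/-- The factor `(n / 2) (W_max - 1) + 1` for even `n`. -/
def scale (n Wmax : ℕ) : ℤ := (n / 2 : ℕ) * ((Wmax : ℤ) - 1) + 1

/-- Step 1: the perturbed weights. -/
def tildeWeight (Wmax : ℕ) (w : G.edgeSet → ℤ) (W : G.edgeSet → ℕ) : G.edgeSet → ℤ :=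
  fun e => scale n Wmax * w e + W e

open Classical in
/-- Step 2: the matrix `B` for nonnegative weights `u`. -/
def tutte (d : ℕ) (u : G.edgeSet → ℤ) : Matrix (Fin n) (Fin n) (Trunc d) :=
  fun i j => if h : G.Adj i j then Trunc.X d ^ (u ⟨s(i, j), h⟩).toNat else 0

/-- End of step 3: the number `w*` from the determinant. -/
def minWeight {d : ℕ} (D : Trunc d) : ℕ := D.degMin / 2

/-- End of step 4: the output, from the weights `u`, the minors and `w*`; `none` is the failure
indicator. -/
def select {d : ℕ} (u : G.edgeSet → ℤ) (minor : Fin n × Fin n → Trunc d) (ws : ℕ) :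
    Option (Set (Sym2 (Fin n))) :=
  if ws = 0 then none
  else some {e | ∃ (i j : Fin n) (h : G.Adj i j), e = s(i, j) ∧
    (minor (i, j) * Trunc.X d ^ (u ⟨s(i, j), h⟩).toNat).degMin = 2 * ws}

/-- The whole algorithm, for the truncation threshold `d`. -/
def decoder (d Wmax : ℕ) (w : G.edgeSet → ℤ) (W : G.edgeSet → ℕ) :
    Option (Set (Sym2 (Fin n))) :=
  let u := tildeWeight G Wmax w W
  let B := tutte G d u
  select G u (fun p => (removed B p.1 p.2).det) (minWeight B.det)

end Algorithm

/-! ### Bit encodings of the inputs, outputs and intermediate data -/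

section Encoding

variable {n : ℕ} (G : SimpleGraph (Fin n))

open Classical in
/-- The adjacency matrix. -/
def graphBits : Fin n × Fin n → Bool := fun p => decide (G.Adj p.1 p.2)

open Classical in
/-- Integers on the edges, in two's complement with `len + 1` bits. -/
def intBits (len : ℕ) (u : G.edgeSet → ℤ) : (Fin n × Fin n) × Fin (len + 1) → Bool :=
  fun p => if h : G.Adj p.1.1 p.1.2 then (u ⟨s(p.1.1, p.1.2), h⟩).testBit p.2 else false

open Classical in
/-- Natural numbers on the edges, in binary with `len` bits. -/
def natBits (len : ℕ) (W : G.edgeSet → ℕ) : (Fin n × Fin n) × Fin len → Bool :=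
  fun p => if h : G.Adj p.1.1 p.1.2 then (W ⟨s(p.1.1, p.1.2), h⟩).testBit p.2 else false

/-- A natural number in binary with `len` bits. -/
def numBits (len : ℕ) (k : ℕ) : Fin len → Bool := fun i => k.testBit i

open Classical in
/-- The output: the failure bit, and for every pair of vertices whether it was selected. -/
def outputBits : Option (Set (Sym2 (Fin n))) → Option (Fin n × Fin n) → Bool
  | none, none => true
  | none, some _ => false
  | some _, none => false
  | some M, some p => decide (s(p.1, p.2) ∈ M)

/-- The bits of the input of the algorithm. -/
def inputBits (b Wmax : ℕ) (w : G.edgeSet → ℤ) (W : G.edgeSet → ℕ) :=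
  Sum.elim (graphBits G) (Sum.elim (intBits G b w) (natBits G (Nat.size Wmax) W))

/-- A bit length that suffices for the perturbed weights when `b` suffices for the weights. -/
def tildeLen (n Wmax b : ℕ) : ℕ := b + Nat.size ((n + 1) * (Wmax + 1))

end Encoding

end MWPM

end

noncomputable section

namespace MWPM

/-! ### Composing circuits -/

/-- Substitution of wires for the inputs and the gates of a wire. -/
def Wire.bind {ι ι' γ γ' : Type} (f : ι → Wire ι' γ') (g : γ → Wire ι' γ') :
    Wire ι γ → Wire ι' γ'
  | .zero => .zero
  | .one => .one
  | .negOne => .negOne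
  | .input i => f i
  | .gate c => g c

section Wire

variable {R : Type*} [CommRing R] {ι ι' γ γ' : Type}

theorem Wire.val_bind (f : ι → Wire ι' γ') (g : γ → Wire ι' γ') (u : Wire ι γ) (x : ι' → R)
    (v : γ' → R) :
    (u.bind f g).val x v = u.val (fun i => (f i).val x v) (fun c => (g c).val x v) := by
  cases u <;> rfl

theorem Wire.val_congr {u : Wire ι γ} {x : ι → R} {v v' : γ → R}
    (h : ∀ c, u = .gate c → v c = v' c) : u.val x v = u.val x v' := by
  cases u <;> simp_all [Wire.val]

theorem Wire.exists_of_bind_eq_gate {f : ι → Wire ι' γ'} {g : γ → Wire ι' γ'} {u : Wire ι γ}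
    {c : γ'} (h : u.bind f g = .gate c) :
    (∃ i, u = .input i ∧ f i = .gate c) ∨ ∃ b, u = .gate b ∧ g b = .gate c := by
  cases u <;> simp_all [Wire.bind]

end Wire

namespace Circuit

variable {ι μ o o' o'' : Type} {R : Type*} [CommRing R]

theorem time_lt_depth (C : Circuit ι o) (g : C.Gate) : C.time g < C.depth :=
  Finset.le_sup (f := fun g => C.time g + 1) (@Finset.mem_univ _ C.finite g)

theorem depth_le_iff (C : Circuit ι o) (T : ℕ) : C.depth ≤ T ↔ ∀ g, C.time g < T := by
  simp [depth, Finset.sup_le_iff]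

/-- The circuit that runs `C` first and then `D`, whose inputs are read on wires of `C`. -/
def extend (C : Circuit ι o) (D : Circuit μ o') (s : μ → Wire ι C.Gate)
    (out : o'' → Wire ι (C.Gate ⊕ D.Gate)) : Circuit ι o'' where
  Gate := C.Gate ⊕ D.Gate
  finite := letI := C.finite; letI := D.finite; inferInstance
  op := Sum.elim C.op D.op
  left := Sum.elim (fun g => (C.left g).bind .input fun h => .gate (.inl h))
    fun g => (D.left g).bind (fun i => (s i).bind .input fun h => .gate (.inl h))
      fun h => .gate (.inr h)
  right := Sum.elim (fun g => (C.right g).bind .input fun h => .gate (.inl h))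
    fun g => (D.right g).bind (fun i => (s i).bind .input fun h => .gate (.inl h))
      fun h => .gate (.inr h)
  time := Sum.elim C.time fun g => C.depth + D.time g
  left_lt := by
    rintro (g | g) h hg
    · obtain ⟨i, -, hi⟩ | ⟨b, hb, hi⟩ := Wire.exists_of_bind_eq_gate hg
      · cases hi
      · cases hi; exact C.left_lt g b hb
    · obtain ⟨i, -, hi⟩ | ⟨b, hb, hi⟩ := Wire.exists_of_bind_eq_gate hg
      · obtain ⟨i', -, hi'⟩ | ⟨b, hb, hi'⟩ := Wire.exists_of_bind_eq_gate hi
        · cases hi'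
        · cases hi'; exact (C.time_lt_depth b).trans_le (Nat.le_add_right _ _)
      · cases hi; exact Nat.add_lt_add_left (D.left_lt g b hb) _
  right_lt := by
    rintro (g | g) h hg
    · obtain ⟨i, -, hi⟩ | ⟨b, hb, hi⟩ := Wire.exists_of_bind_eq_gate hg
      · cases hi
      · cases hi; exact C.right_lt g b hb
    · obtain ⟨i, -, hi⟩ | ⟨b, hb, hi⟩ := Wire.exists_of_bind_eq_gate hg
      · obtain ⟨i', -, hi'⟩ | ⟨b, hb, hi'⟩ := Wire.exists_of_bind_eq_gate hi
        · cases hi'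
        · cases hi'; exact (C.time_lt_depth b).trans_le (Nat.le_add_right _ _)
      · cases hi; exact Nat.add_lt_add_left (D.right_lt g b hb) _
  out := out

section extend

variable (C : Circuit ι o) (D : Circuit μ o') (s : μ → Wire ι C.Gate)
    (out : o'' → Wire ι (C.Gate ⊕ D.Gate)) (x : ι → R)

theorem depth_extend_le : (C.extend D s out).depth ≤ C.depth + D.depth := by
  rw [depth_le_iff]
  rintro (g | g)
  · exact (C.time_lt_depth g).trans_le (Nat.le_add_right _ _)
  · exact Nat.add_lt_add_left (D.time_lt_depth g) _

theorem size_extend : (C.extend D s out).size = C.size + D.size := by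
  let := C.finite; let := D.finite
  exact Fintype.card_sum

theorem gateVal_extend_inl (g : C.Gate) :
    (C.extend D s out).gateVal x (.inl g) = C.gateVal x g := by
  induction h : C.time g using Nat.strong_induction_on generalizing g with
  | _ t ih =>
    refine (gateVal_eq _ _ _).trans ((congrArg₂ (C.op g).run ?_ ?_).trans (gateVal_eq _ _ _).symm)
    · refine (Wire.val_bind _ _ (C.left g) x _).trans (Wire.val_congr fun c hc => ?_)
      exact ih _ (h ▸ C.left_lt g c hc) c rfl
    · refine (Wire.val_bind _ _ (C.right g) x _).trans (Wire.val_congr fun c hc => ?_)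
      exact ih _ (h ▸ C.right_lt g c hc) c rfl

theorem wireVal_extend_inl (u : Wire ι C.Gate) :
    (C.extend D s out).wireVal x (u.bind .input fun h => .gate (.inl h)) = C.wireVal x u :=
  (Wire.val_bind _ _ u x _).trans
    (Wire.val_congr fun c _ => C.gateVal_extend_inl D s out x c)

theorem wireVal_extend_inr_of (u : Wire μ D.Gate)
    (hu : ∀ c, u = .gate c →
      (C.extend D s out).gateVal x (.inr c) = D.gateVal (fun i => C.wireVal x (s i)) c) :
    (C.extend D s out).wireVal x (u.bind (fun i => (s i).bind .input fun h => .gate (.inl h))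
        fun h => .gate (.inr h)) = D.wireVal (fun i => C.wireVal x (s i)) u :=
  (Wire.val_bind _ _ u x _).trans <|
    (congrArg (fun f => u.val f _) (funext fun i => C.wireVal_extend_inl D s out x (s i))).trans
      (Wire.val_congr hu)

theorem gateVal_extend_inr (g : D.Gate) :
    (C.extend D s out).gateVal x (.inr g) = D.gateVal (fun i => C.wireVal x (s i)) g := by
  induction h : D.time g using Nat.strong_induction_on generalizing g with
  | _ t ih =>
    refine (gateVal_eq _ _ _).trans ((congrArg₂ (D.op g).run ?_ ?_).trans (gateVal_eq _ _ _).symm)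
    · exact wireVal_extend_inr_of _ _ _ _ _ _ fun c hc => ih _ (h ▸ D.left_lt g c hc) c rfl
    · exact wireVal_extend_inr_of _ _ _ _ _ _ fun c hc => ih _ (h ▸ D.right_lt g c hc) c rfl

theorem wireVal_extend_inr (u : Wire μ D.Gate) :
    (C.extend D s out).wireVal x (u.bind (fun i => (s i).bind .input fun h => .gate (.inl h))
        fun h => .gate (.inr h)) = D.wireVal (fun i => C.wireVal x (s i)) u :=
  C.wireVal_extend_inr_of D s out x u fun c _ => C.gateVal_extend_inr D s out x c

end extend

/-- The circuit `C` followed by `D`. -/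
def seq (C : Circuit ι μ) (D : Circuit μ o) : Circuit ι o :=
  C.extend D C.out fun k => (D.out k).bind (fun i => (C.out i).bind .input fun h => .gate (.inl h))
    fun h => .gate (.inr h)

theorem eval_seq (C : Circuit ι μ) (D : Circuit μ o) (x : ι → R) :
    (C.seq D).eval x = D.eval (C.eval x) :=
  funext fun k => C.wireVal_extend_inr D C.out _ x (D.out k)

/-- The circuits `C` and `D` on the same input. -/
def pair (C : Circuit ι o) (D : Circuit ι o') : Circuit ι (o ⊕ o') :=
  C.extend D .input <| Sum.elim (fun k => (C.out k).bind .input fun h => .gate (.inl h))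
    fun k => (D.out k).bind (fun i => (Wire.input i).bind .input fun h => .gate (.inl h))
      fun h => .gate (.inr h)

theorem eval_pair (C : Circuit ι o) (D : Circuit ι o') (x : ι → R) :
    (C.pair D).eval x = Sum.elim (C.eval x) (D.eval x) := by
  funext k
  cases k with
  | inl k => exact C.wireVal_extend_inl D .input _ x (C.out k)
  | inr k => exact C.wireVal_extend_inr D .input _ x (D.out k)

/-- A circuit without gates. -/
def wiring (s : o → Wire ι Empty) : Circuit ι o where
  Gate := Empty
  op := Empty.elim
  left := Empty.elim
  right := Empty.elim
  time := Empty.elim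
  left_lt := fun g => g.elim
  right_lt := fun g => g.elim
  out := s

theorem depth_wiring (s : o → Wire ι Empty) : (wiring s).depth = 0 :=
  Nat.le_zero.1 <| (depth_le_iff _ _).2 fun g => g.elim

theorem size_wiring (s : o → Wire ι Empty) : (wiring s).size = 0 := rfl

theorem eval_wiring (s : o → Wire ι Empty) (x : ι → R) (k : o) :
    (wiring s).eval x k = (s k).val x Empty.elim :=
  Wire.val_congr fun c _ => c.elim

/-- One time step that executes an operation on pairs of inputs. -/
def layer [Fintype o] (f : Op) : Circuit (o ⊕ o) o where
  Gate := o
  op _ := f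
  left k := .input (.inl k)
  right k := .input (.inr k)
  time _ := 0
  left_lt _ _ h := by cases h
  right_lt _ _ h := by cases h
  out := .gate

theorem depth_layer_le [Fintype o] (f : Op) : (layer f : Circuit (o ⊕ o) o).depth ≤ 1 :=
  (depth_le_iff _ _).2 fun _ => Nat.zero_lt_one

theorem size_layer [Fintype o] (f : Op) :
    (layer f : Circuit (o ⊕ o) o).size = Fintype.card o := rfl

theorem eval_layer [Fintype o] (f : Op) (x : o ⊕ o → R) (k : o) :
    (layer f).eval x k = f.run (x (.inl k)) (x (.inr k)) :=
  gateVal_eq _ _ _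

theorem Polylog.mono {C : Circuit ι o} {c c' N : ℕ} (hN : 2 ≤ N) (h : C.Polylog c N)
    (hc : c ≤ c') : C.Polylog c' N :=
  ⟨h.1.trans <| Nat.mul_le_mul hc <| Nat.pow_le_pow_right (Nat.log_pos one_lt_two hN) hc,
    h.2.trans <| Nat.mul_le_mul hc <| Nat.pow_le_pow_right (by omega) hc⟩

end Circuit

/-! ### Polynomial bounds -/

/-- The function `f` is bounded by a polynomial in `N`. -/
def PolyBounded {P : Type} (N f : P → ℕ) : Prop := ∃ c, ∀ p, f p ≤ c * N p ^ c

namespace PolyBounded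

variable {P : Type} {N f g : P → ℕ}

theorem mono (hg : PolyBounded N g) (h : ∀ p, f p ≤ g p) : PolyBounded N f :=
  hg.imp fun _ hc p => (h p).trans (hc p)

theorem comp {Q : Type} (hf : PolyBounded N f) (s : Q → P) : PolyBounded (N ∘ s) (f ∘ s) :=
  hf.imp fun _ hc q => hc (s q)

theorem self : PolyBounded N N := ⟨1, fun p => by simp⟩

theorem const (hN : ∀ p, 1 ≤ N p) (k : ℕ) : PolyBounded N fun _ => k :=
  ⟨k, fun p => Nat.le_mul_of_pos_right _ (Nat.pow_pos (hN p))⟩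

theorem add (hN : ∀ p, 1 ≤ N p) (hf : PolyBounded N f) (hg : PolyBounded N g) :
    PolyBounded N fun p => f p + g p := by
  obtain ⟨c, hc⟩ := hf
  obtain ⟨e, he⟩ := hg
  refine ⟨c + e, fun p => (Nat.add_le_add (hc p) (he p)).trans ?_⟩
  rw [Nat.add_mul]
  gcongr <;> first | exact hN p | omega

theorem mul (hN : ∀ p, 1 ≤ N p) (hf : PolyBounded N f) (hg : PolyBounded N g) :
    PolyBounded N fun p => f p * g p := by
  obtain ⟨c, hc⟩ := hf
  obtain ⟨e, he⟩ := hg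
  refine ⟨c * e + c + e, fun p => (Nat.mul_le_mul (hc p) (he p)).trans ?_⟩
  rw [mul_mul_mul_comm, ← pow_add]
  gcongr
  · omega
  · exact hN p
  · omega

theorem pow (hN : ∀ p, 1 ≤ N p) (hf : PolyBounded N f) (k : ℕ) :
    PolyBounded N fun p => f p ^ k := by
  induction k with
  | zero => simpa using const hN 1
  | succ k ih => simpa only [pow_succ] using ih.mul hN hf

theorem clog (hN : ∀ p, 2 ≤ N p) (hf : PolyBounded N f) :
    PolyBounded (fun p => Nat.log 2 (N p)) (fun p => Nat.clog 2 (f p)) := by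
  have hlog : ∀ p, 1 ≤ Nat.log 2 (N p) := fun p => Nat.log_pos one_lt_two (hN p)
  obtain ⟨c, hc⟩ := hf
  refine mono ((const hlog c).add hlog ((const hlog c).mul hlog (self.add hlog (const hlog 1))))
    fun p => Nat.clog_le_of_le_pow ((hc p).trans ?_)
  rw [pow_add, mul_comm c (_ + 1), pow_mul]
  gcongr
  · exact Nat.lt_two_pow_self.le
  · exact (Nat.lt_pow_succ_log_self one_lt_two _).le

end PolyBounded

/-- A type of problem parameters with a size. -/
class Sized (P : Type) where
  /-- the size -/
  size : P → ℕ
  two_le_size : ∀ p, 2 ≤ size p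

instance {P : Type} [Sized P] : Sized (P × ℕ) where
  size q := Sized.size q.1
  two_le_size q := Sized.two_le_size q.1

/-- The function `f` is polynomially bounded. -/
abbrev Poly {P : Type} [Sized P] (f : P → ℕ) : Prop := PolyBounded Sized.size f

/-- The function `f` is polylogarithmically bounded. -/
abbrev Polylog {P : Type} [Sized P] (f : P → ℕ) : Prop :=
  PolyBounded (fun p => Nat.log 2 (Sized.size p)) f

section Sized

variable {P : Type} [Sized P] {f g : P → ℕ}

theorem Sized.one_le_size (p : P) : 1 ≤ Sized.size p :=
  one_le_two.trans (Sized.two_le_size p)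

theorem Sized.one_le_log (p : P) : 1 ≤ Nat.log 2 (Sized.size p) :=
  Nat.log_pos one_lt_two (Sized.two_le_size p)

theorem Poly.const (k : ℕ) : Poly fun _ : P => k := PolyBounded.const Sized.one_le_size k

theorem Poly.add (hf : Poly f) (hg : Poly g) : Poly fun p => f p + g p :=
  PolyBounded.add Sized.one_le_size hf hg

theorem Poly.mul (hf : Poly f) (hg : Poly g) : Poly fun p => f p * g p :=
  PolyBounded.mul Sized.one_le_size hf hg

theorem Poly.clog (hf : Poly f) : Polylog fun p => Nat.clog 2 (f p) :=
  PolyBounded.clog Sized.two_le_size hf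

theorem Polylog.const (k : ℕ) : Polylog fun _ : P => k := PolyBounded.const Sized.one_le_log k

theorem Polylog.add (hf : Polylog f) (hg : Polylog g) : Polylog fun p => f p + g p :=
  PolyBounded.add Sized.one_le_log hf hg

theorem Polylog.mul (hf : Polylog f) (hg : Polylog g) : Polylog fun p => f p * g p :=
  PolyBounded.mul Sized.one_le_log hf hg

theorem Poly.lift (hf : Poly f) : Poly fun q : P × ℕ => f q.1 := PolyBounded.comp hf Prod.fst

theorem Polylog.poly (hf : Polylog f) : Poly f :=
  hf.imp fun _ hc p => (hc p).trans <|
    Nat.mul_le_mul_left _ (Nat.pow_le_pow_left (Nat.log_le_self _ _) _)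

end Sized

/-! ### Families of circuits of polylogarithmic depth and polynomial size -/

/-- For every parameter `p`, one circuit computes `y p a` from `x p a` for all instances `a`, and
these circuits have polylogarithmic depth and polynomial size. -/
def NC {P : Type} [Sized P] {A : P → Type*} {R : ∀ p, A p → Type} [∀ p a, CommRing (R p a)]
    {ι o : P → Type} (x : ∀ p (a : A p), ι p → R p a) (y : ∀ p (a : A p), o p → R p a) : Prop :=
  ∃ T S : P → ℕ, Polylog T ∧ Poly S ∧ ∀ p, ∃ C : Circuit (ι p) (o p),
    C.depth ≤ T p ∧ C.size ≤ S p ∧ ∀ a, C.eval (x p a) = y p a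

namespace NC

variable {P : Type} [Sized P] {A : P → Type*} {R : ∀ p, A p → Type} [∀ p a, CommRing (R p a)]
    {ι o o' o'' : P → Type} {x : ∀ p (a : A p), ι p → R p a} {y : ∀ p (a : A p), o p → R p a}
    {z : ∀ p (a : A p), o' p → R p a}

theorem exists_polylog (h : NC x y) : ∃ c, ∀ p, ∃ C : Circuit (ι p) (o p),
    C.Polylog c (Sized.size p) ∧ ∀ a, C.eval (x p a) = y p a := by
  obtain ⟨T, S, ⟨c, hT⟩, ⟨e, hS⟩, h⟩ := h
  refine ⟨c + e, fun p => ?_⟩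
  obtain ⟨C, hCT, hCS, hC⟩ := h p
  refine ⟨C, ⟨(hCT.trans (hT p)).trans ?_, (hCS.trans (hS p)).trans ?_⟩, hC⟩
  · gcongr <;> first | exact Sized.one_le_log p | omega
  · gcongr <;> first | exact Sized.one_le_size p | omega

theorem of_polylog {c : ℕ} (h : ∀ p, ∃ C : Circuit (ι p) (o p),
    C.Polylog c (Sized.size p) ∧ ∀ a, C.eval (x p a) = y p a) : NC x y :=
  ⟨_, _, ⟨c, fun _ => le_rfl⟩, ⟨c, fun _ => le_rfl⟩,
    fun p => (h p).imp fun _ hC => ⟨hC.1.1, hC.1.2, hC.2⟩⟩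

theorem congr {y' : ∀ p (a : A p), o p → R p a} (h : NC x y) (e : ∀ p a k, y p a k = y' p a k) :
    NC x y' := by
  obtain rfl : y = y' := funext fun p => funext fun a => funext (e p a)
  exact h

theorem trans (h : NC x y) (h' : NC y z) : NC x z := by
  obtain ⟨T, S, hT, hS, h⟩ := h
  obtain ⟨T', S', hT', hS', h'⟩ := h'
  refine ⟨_, _, hT.add hT', hS.add hS', fun p => ?_⟩
  obtain ⟨C, hCT, hCS, hC⟩ := h p
  obtain ⟨D, hDT, hDS, hD⟩ := h' p
  refine ⟨C.seq D, (C.depth_extend_le D _ _).trans (Nat.add_le_add hCT hDT),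
    (C.size_extend D _ _).trans_le (Nat.add_le_add hCS hDS), fun a => ?_⟩
  rw [Circuit.eval_seq, hC, hD]

theorem pair (h : NC x y) (h' : NC x z) : NC x fun p a => Sum.elim (y p a) (z p a) := by
  obtain ⟨T, S, hT, hS, h⟩ := h
  obtain ⟨T', S', hT', hS', h'⟩ := h'
  refine ⟨_, _, hT.add hT', hS.add hS', fun p => ?_⟩
  obtain ⟨C, hCT, hCS, hC⟩ := h p
  obtain ⟨D, hDT, hDS, hD⟩ := h' p
  refine ⟨C.pair D, (C.depth_extend_le D _ _).trans (Nat.add_le_add hCT hDT),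
    (C.size_extend D _ _).trans_le (Nat.add_le_add hCS hDS), fun a => ?_⟩
  rw [Circuit.eval_pair, hC, hD]

/-- Circuits without gates. -/
theorem wire (x : ∀ p (a : A p), ι p → R p a) (s : ∀ p, o p → Wire (ι p) Empty) :
    NC x fun p a k => (s p k).val (x p a) Empty.elim :=
  ⟨_, _, .const 0, .const 0, fun p => ⟨.wiring (s p), (Circuit.depth_wiring _).le,
    (Circuit.size_wiring _).le, fun _ => funext fun _ => Circuit.eval_wiring _ _ _⟩⟩

protected theorem input (x : ∀ p (a : A p), ι p → R p a) (s : ∀ p, o p → ι p) :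
    NC x fun p a k => x p a (s p k) :=
  wire x fun p k => .input (s p k)

protected theorem refl (x : ∀ p (a : A p), ι p → R p a) : NC x x := NC.input x fun _ k => k

theorem reindex (h : NC x y) (s : ∀ p, o' p → o p) : NC x fun p a k => y p a (s p k) :=
  h.trans (NC.input y s)

theorem zero (x : ∀ p (a : A p), ι p → R p a) : NC x fun p a (_ : o p) => (0 : R p a) :=
  wire x fun _ _ => .zero

theorem one (x : ∀ p (a : A p), ι p → R p a) : NC x fun p a (_ : o p) => (1 : R p a) :=
  wire x fun _ _ => .one

theorem negOne (x : ∀ p (a : A p), ι p → R p a) : NC x fun p a (_ : o p) => (-1 : R p a) :=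
  wire x fun _ _ => .negOne

/-- A case distinction that does not depend on the instance. -/
theorem ite (c : ∀ p, o p → Prop) [∀ p k, Decidable (c p k)] {y z : ∀ p (a : A p), o p → R p a}
    (h : NC x y) (h' : NC x z) : NC x fun p a k => if c p k then y p a k else z p a k :=
  ((h.pair h').reindex fun p k => if c p k then .inl k else .inr k).congr fun p a k => by
    split_ifs <;> rfl

theorem dite (c : ∀ p, o p → Prop) [∀ p k, Decidable (c p k)] (s : ∀ p k, c p k → o' p)
    (h' : NC x z) (h : NC x y) :
    NC x fun p a k => if h : c p k then z p a (s p k h) else y p a k :=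
  ((h'.pair h).reindex fun p k => if h : c p k then .inl (s p k h) else .inr k).congr
    fun p a k => by split_ifs <;> rfl

theorem op (f : Op) [∀ p, Fintype (o p)] (ho : Poly fun p => Fintype.card (o p))
    {y z : ∀ p (a : A p), o p → R p a} (h : NC x y) (h' : NC x z) :
    NC x fun p a k => f.run (y p a k) (z p a k) := by
  refine (h.pair h').trans ⟨_, _, .const 1, ho, fun p => ⟨.layer f, Circuit.depth_layer_le f,
    (Circuit.size_layer f).le, fun a => funext fun k => Circuit.eval_layer f _ k⟩⟩

theorem add [∀ p, Fintype (o p)] (ho : Poly fun p => Fintype.card (o p))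
    {y z : ∀ p (a : A p), o p → R p a} (h : NC x y) (h' : NC x z) :
    NC x fun p a k => y p a k + z p a k := op .add ho h h'

theorem mul [∀ p, Fintype (o p)] (ho : Poly fun p => Fintype.card (o p))
    {y z : ∀ p (a : A p), o p → R p a} (h : NC x y) (h' : NC x z) :
    NC x fun p a k => y p a k * z p a k := op .mul ho h h'

/-- Restriction to other instances. -/
theorem comap {A' : P → Type*} (h : NC x y) (s : ∀ p, A' p → A p) :
    NC (fun p a => x p (s p a)) fun p a => y p (s p a) := by
  obtain ⟨T, S, hT, hS, h⟩ := h
  exact ⟨T, S, hT, hS, fun p => (h p).imp fun C hC => ⟨hC.1, hC.2.1, fun a => hC.2.2 (s p a)⟩⟩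

/-- Polylogarithmically many steps. -/
theorem iterate (y : ∀ p, ℕ → ∀ a : A p, o p → R p a) (T : P → ℕ) (hT : Polylog T)
    (h : NC (P := P × ℕ) (A := fun q => A q.1) (R := fun q a => R q.1 a)
      (fun q a => y q.1 q.2 a) fun q a => y q.1 (q.2 + 1) a) :
    NC (fun p a => y p 0 a) fun p a => y p (T p) a := by
  obtain ⟨c, h⟩ := h.exists_polylog
  refine ⟨_, _, hT.mul ⟨c, fun _ => le_rfl⟩, hT.poly.mul ⟨c, fun _ => le_rfl⟩, fun p => ?_⟩
  beta_reduce
  generalize T p = t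
  induction t with
  | zero =>
    exact ⟨.wiring .input, by simp [Circuit.depth_wiring], by simp [Circuit.size_wiring],
      fun a => funext fun k => Circuit.eval_wiring _ _ _⟩
  | succ t ih =>
    obtain ⟨C, hCT, hCS, hC⟩ := ih
    obtain ⟨D, ⟨hDT, hDS⟩, hD⟩ := h (p, t)
    refine ⟨C.seq D, (C.depth_extend_le D _ _).trans ?_, (C.size_extend D _ _).trans_le ?_,
      fun a => ?_⟩
    · rw [Nat.add_mul, Nat.one_mul]
      exact Nat.add_le_add hCT hDT
    · rw [Nat.add_mul, Nat.one_mul]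
      exact Nat.add_le_add hCS hDS
    · rw [Circuit.eval_seq, hC, hD]

end NC

/-! ### Reductions along a binary tree -/

/-- The value at node `i` of height `r` in the complete binary tree with leaves `v`. -/
def segment {M : Type*} (op : M → M → M) (v : ℕ → M) : ℕ → ℕ → M
  | 0, i => v i
  | r + 1, i => op (segment op v r (2 * i)) (segment op v r (2 * i + 1))

theorem segment_eq_of_le {M : Type*} {op : M → M → M} {v : ℕ → M} {e : M} (he : op e e = e)
    {L : ℕ} (hv : ∀ s, L ≤ s → v s = e) (r i : ℕ) (hi : L ≤ i) : segment op v r i = e := by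
  induction r generalizing i with
  | zero => exact hv i hi
  | succ r ih => rw [segment, ih _ (by omega), ih _ (by omega), he]

@[to_additive]
theorem segment_eq_list_prod {M : Type*} [Monoid M] (v : ℕ → M) (r i : ℕ) :
    segment (fun a b => a * b) v r i =
      ((List.range (2 ^ r)).map fun s => v (i * 2 ^ r + s)).prod := by
  induction r generalizing i with
  | zero => simp [segment]
  | succ r ih =>
    rw [segment, ih, ih, pow_succ, mul_two, List.range_add, List.map_append, List.prod_append,
      List.map_map]
    simp only [Function.comp_def, show ∀ s, 2 * i * 2 ^ r + s = i * (2 ^ r * 2) + s by grind,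
      show ∀ s, (2 * i + 1) * 2 ^ r + s = i * (2 ^ r * 2) + (2 ^ r + s) by grind, ← mul_two]

@[to_additive]
theorem segment_mul_eq_list_prod {M : Type*} [Monoid M] (v : ℕ → M) {L T : ℕ} (hT : L ≤ 2 ^ T) :
    segment (fun a b => a * b) (fun s => if s < L then v s else 1) T 0 =
      ((List.range L).map v).prod := by
  obtain ⟨k, hk⟩ := Nat.exists_eq_add_of_le hT
  rw [segment_eq_list_prod, hk, List.range_add, List.map_append, List.prod_append, List.map_map]
  rw [List.prod_eq_one (l := List.map _ (List.range k)) fun x hx => by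
    obtain ⟨s, -, rfl⟩ := List.mem_map.1 hx
    simp, mul_one]
  refine congrArg List.prod (List.map_congr_left fun s hs => ?_)
  simp [List.mem_range.1 hs]

@[to_additive]
theorem segment_eq_prod {M : Type*} [CommMonoid M] {K : Type*} [Fintype K] (y : K → M) {T : ℕ}
    (hT : Fintype.card K ≤ 2 ^ T) :
    segment (fun a b => a * b)
      (fun s => if h : s < Fintype.card K then y ((Fintype.equivFin K).symm ⟨s, h⟩) else 1) T 0 =
      ∏ k, y k := by
  set f : ℕ → M :=
    fun s => if h : s < Fintype.card K then y ((Fintype.equivFin K).symm ⟨s, h⟩) else 1 with hf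
  rw [segment_eq_list_prod]
  simp only [zero_mul, zero_add]
  rw [← List.prod_toFinset _ List.nodup_range, List.toFinset_range,
    ← Finset.prod_subset (Finset.range_subset_range.2 hT) (fun s _ hs => by
      simp [hf, Finset.mem_range.not.1 hs]),
    Finset.prod_range, ← (Fintype.equivFin K).symm.prod_comp]
  exact Finset.prod_congr rfl fun s _ => by simp [hf]

namespace NC

variable {P : Type} [Sized P] {A : P → Type*} {R : ∀ p, A p → Type} [∀ p a, CommRing (R p a)]
    {ι o : P → Type} {x : ∀ p (a : A p), ι p → R p a}

/-- Reduction along a binary tree for data that are encoded by ring elements. -/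
theorem tree {M : ∀ p, A p → Type*} {e κ : P → Type}
    (enc : ∀ p a, M p a → e p → R p a) (op : ∀ p a, M p a → M p a → M p a) (one : ∀ p a, M p a)
    (hone : ∀ p a, op p a (one p a) (one p a) = one p a) {L : P → ℕ} (hL : Poly L)
    (v : ∀ p a, κ p → ℕ → M p a) (hv : ∀ p a k s, L p ≤ s → v p a k s = one p a)
    (hop : ∀ (ι' : P × ℕ → Type) (x' : ∀ q (a : A q.1), ι' q → R q.1 a)
      (u w : ∀ (q : P × ℕ) (a : A q.1), κ q.1 × Fin (L q.1 + 1) → M q.1 a),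
      NC (A := fun q => A q.1) (R := fun q a => R q.1 a) x'
        (fun q a (j : (κ q.1 × Fin (L q.1 + 1)) × e q.1) => enc q.1 a (u q a j.1) j.2) →
      NC (A := fun q => A q.1) (R := fun q a => R q.1 a) x'
        (fun q a (j : (κ q.1 × Fin (L q.1 + 1)) × e q.1) => enc q.1 a (w q a j.1) j.2) →
      NC (A := fun q => A q.1) (R := fun q a => R q.1 a) x'
        (fun q a (j : (κ q.1 × Fin (L q.1 + 1)) × e q.1) =>
          enc q.1 a (op q.1 a (u q a j.1) (w q a j.1)) j.2))
    (h : NC x fun p a (j : (κ p × Fin (L p + 1)) × e p) => enc p a (v p a j.1.1 j.1.2) j.2) :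
    NC x fun p a (j : κ p × e p) =>
      enc p a (segment (op p a) (v p a j.1) (Nat.clog 2 (L p)) 0) j.2 := by
  have step := hop _ (fun q a (j : (κ q.1 × Fin (L q.1 + 1)) × e q.1) =>
      enc q.1 a (segment (op q.1 a) (v q.1 a j.1.1) q.2 j.1.2) j.2)
    (fun q a j => segment (op q.1 a) (v q.1 a j.1) q.2 (2 * j.2))
    (fun q a j => segment (op q.1 a) (v q.1 a j.1) q.2 (2 * j.2 + 1))
    ((NC.input _ fun q j => ((j.1.1, ⟨min (2 * j.1.2) (L q.1), Nat.lt_succ_of_le (min_le_right _ _)⟩), j.2)).congr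
      fun q a j => by
        rcases le_total (2 * (j.1.2 : ℕ)) (L q.1) with hj | hj
        · simp [hj]
        · rw [segment_eq_of_le (hone q.1 a) (hv q.1 a j.1.1) _ _ hj]
          simp [hj, segment_eq_of_le (hone q.1 a) (hv q.1 a j.1.1)])
    ((NC.input _ fun q j => ((j.1.1, ⟨min (2 * j.1.2 + 1) (L q.1), Nat.lt_succ_of_le (min_le_right _ _)⟩), j.2)).congr
      fun q a j => by
        rcases le_total (2 * (j.1.2 : ℕ) + 1) (L q.1) with hj | hj
        · simp [hj]
        · rw [segment_eq_of_le (hone q.1 a) (hv q.1 a j.1.1) _ _ hj]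
          simp [hj, segment_eq_of_le (hone q.1 a) (hv q.1 a j.1.1)])
  have := iterate (fun p r a (j : (κ p × Fin (L p + 1)) × e p) =>
    enc p a (segment (op p a) (v p a j.1.1) r j.1.2) j.2) _ hL.clog step
  exact (h.trans this).reindex fun p (j : κ p × e p) => ((j.1, 0), j.2)

section bigOperators

variable [∀ p, Fintype (o p)] {K : P → Type} [∀ p, Fintype (K p)]

theorem card_prod (ho : Poly fun p => Fintype.card (o p)) (hK : Poly fun p => Fintype.card (K p)) :
    Poly fun p => Fintype.card (o p × K p) := by
  simpa only [Fintype.card_prod] using ho.mul hK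

theorem prod (ho : Poly fun p => Fintype.card (o p)) (hK : Poly fun p => Fintype.card (K p))
    {y : ∀ p (a : A p), o p × K p → R p a} (h : NC x y) :
    NC x fun p a k => ∏ i, y p a (k, i) := by
  have := tree (e := fun _ => Unit) (fun p a (m : R p a) _ => m) (fun p a m m' => m * m')
    (fun p a => 1) (fun p a => mul_one _) hK
    (fun p a k s => if h : s < Fintype.card (K p) then
      y p a (k, (Fintype.equivFin (K p)).symm ⟨s, h⟩) else 1)
    (fun p a k s hs => dif_neg (not_lt.2 hs))
    (fun ι' x' u w hu hw => mul (by
      simpa only [Fintype.card_prod, Fintype.card_fin, Fintype.card_unit] using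
        ((ho.mul (hK.add (.const 1))).mul (.const 1)).lift) hu hw)
    (dite (fun p (j : (o p × Fin (Fintype.card (K p) + 1)) × Unit) =>
        (j.1.2 : ℕ) < Fintype.card (K p))
      (fun p j h => (j.1.1, (Fintype.equivFin (K p)).symm ⟨j.1.2, h⟩)) h (one x))
  refine (this.reindex fun p k => (k, ())).congr fun p a k => ?_
  exact segment_eq_prod (fun i => y p a (k, i)) (Nat.le_pow_clog one_lt_two _)

theorem sum (ho : Poly fun p => Fintype.card (o p)) (hK : Poly fun p => Fintype.card (K p))
    {y : ∀ p (a : A p), o p × K p → R p a} (h : NC x y) :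
    NC x fun p a k => ∑ i, y p a (k, i) := by
  have := tree (e := fun _ => Unit) (fun p a (m : R p a) _ => m) (fun p a m m' => m + m')
    (fun p a => 0) (fun p a => add_zero _) hK
    (fun p a k s => if h : s < Fintype.card (K p) then
      y p a (k, (Fintype.equivFin (K p)).symm ⟨s, h⟩) else 0)
    (fun p a k s hs => dif_neg (not_lt.2 hs))
    (fun ι' x' u w hu hw => add (by
      simpa only [Fintype.card_prod, Fintype.card_fin, Fintype.card_unit] using
        ((ho.mul (hK.add (.const 1))).mul (.const 1)).lift) hu hw)
    (dite (fun p (j : (o p × Fin (Fintype.card (K p) + 1)) × Unit) =>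
        (j.1.2 : ℕ) < Fintype.card (K p))
      (fun p j h => (j.1.1, (Fintype.equivFin (K p)).symm ⟨j.1.2, h⟩)) h (zero x))
  refine (this.reindex fun p k => (k, ())).congr fun p a k => ?_
  exact segment_eq_sum (fun i => y p a (k, i)) (Nat.le_pow_clog one_lt_two _)

/-- Products of families of matrices. -/
theorem matrixMul {κ : P → Type} [∀ p, Fintype (κ p)] (hκ : Poly fun p => Fintype.card (κ p))
    (hK : Poly fun p => Fintype.card (K p))
    {y z : ∀ p (a : A p), κ p → Matrix (K p) (K p) (R p a)}
    (hy : NC x fun p a (j : κ p × K p × K p) => y p a j.1 j.2.1 j.2.2)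
    (hz : NC x fun p a (j : κ p × K p × K p) => z p a j.1 j.2.1 j.2.2) :
    NC x fun p a (j : κ p × K p × K p) => (y p a j.1 * z p a j.1) j.2.1 j.2.2 := by
  have ho := card_prod hκ (card_prod hK hK)
  exact sum ho hK (mul (card_prod ho hK)
    (hy.reindex fun p (j : (κ p × K p × K p) × K p) => (j.1.1, j.1.2.1, j.2))
    (hz.reindex fun p (j : (κ p × K p × K p) × K p) => (j.1.1, j.2, j.1.2.2)))

/-- Iterated products of families of matrices. -/
theorem matrixListProd [∀ p, DecidableEq (K p)] {κ : P → Type} [∀ p, Fintype (κ p)]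
    (hκ : Poly fun p => Fintype.card (κ p)) (hK : Poly fun p => Fintype.card (K p)) {L : P → ℕ}
    (hL : Poly L) {v : ∀ p (a : A p), κ p → ℕ → Matrix (K p) (K p) (R p a)}
    (h : NC x fun p a (j : (κ p × Fin (L p)) × K p × K p) => v p a j.1.1 j.1.2 j.2.1 j.2.2) :
    NC x fun p a (j : κ p × K p × K p) =>
      ((List.range (L p)).map (v p a j.1)).prod j.2.1 j.2.2 := by
  have := tree (e := fun p => K p × K p)
    (fun p a (m : Matrix (K p) (K p) (R p a)) j => m j.1 j.2) (fun p a m m' => m * m')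
    (fun p a => 1) (fun p a => mul_one _) hL
    (fun p a k s => if s < L p then v p a k s else 1)
    (fun p a k s hs => if_neg (not_lt.2 hs))
    (fun ι' x' u w hu hw => matrixMul (K := fun q : P × ℕ => K q.1) (by
      simpa only [Fintype.card_prod, Fintype.card_fin] using
        (hκ.mul (hL.add (.const 1))).lift) hK.lift hu hw)
    ((dite (fun p (j : (κ p × Fin (L p + 1)) × K p × K p) => (j.1.2 : ℕ) < L p)
      (fun p j h => ((j.1.1, ⟨j.1.2, h⟩), j.2)) h
      (ite (fun p j => j.2.1 = j.2.2) (one x) (zero x))).congr fun p a j => by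
        split_ifs <;> simp_all [Matrix.one_apply])
  refine this.congr fun p a j => ?_
  rw [segment_mul_eq_list_prod _ (Nat.le_pow_clog one_lt_two _)]

end bigOperators

end NC

/-! ### Correctness of the Samuelson–Berkowitz algorithm -/

section Determinant

open Matrix

variable {R : Type*} [CommRing R]

theorem coe_charpolyRev {n : Type*} [Fintype n] [DecidableEq n] (M : Matrix n n R) :
    (M.charpolyRev : PowerSeries R) =
      (1 - (PowerSeries.X : PowerSeries R) • M.map (PowerSeries.C (R := R))).det := by
  rw [charpolyRev, ← Polynomial.coeToPowerSeries.ringHom_apply, RingHom.map_det]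
  congr 1
  ext i j : 1
  simp [Matrix.one_apply, apply_ite]
  exact mul_comm _ _

theorem coeff_charpolyRev_card {n : Type*} [Fintype n] [DecidableEq n] (M : Matrix n n R) :
    M.charpolyRev.coeff (Fintype.card n) = (-1) ^ Fintype.card n * M.det := by
  nontriviality R
  rw [← reverse_charpoly, Polynomial.coeff_reverse, M.charpoly_natDegree_eq_dim,
    Polynomial.revAt_le le_rfl, Nat.sub_self, det_eq_sign_charpoly_coeff, ← mul_assoc, ← mul_pow]
  simp

theorem coeff_charpolyRev_of_lt {n : Type*} [Fintype n] [DecidableEq n] (M : Matrix n n R) {i : ℕ}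
    (hi : Fintype.card n < i) : M.charpolyRev.coeff i = 0 := by
  nontriviality R
  rw [← reverse_charpoly]
  exact Polynomial.coeff_eq_zero_of_natDegree_lt
    ((Polynomial.reverse_natDegree_le _).trans_lt (M.charpoly_natDegree_eq_dim ▸ hi))

theorem charpolyRev_reindex {n n' : Type*} [Fintype n] [DecidableEq n] [Fintype n']
    [DecidableEq n'] (e : n ≃ n') (M : Matrix n n R) :
    (reindex e e M).charpolyRev = M.charpolyRev := by
  rw [← reverse_charpoly, charpoly_reindex, reverse_charpoly]

/-- The entries of the Toeplitz matrix for a bordered matrix. -/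
def borderCoeff {n : Type*} [Fintype n] [DecidableEq n] (M : Matrix n n R) (S r : n → R) (a : R) :
    ℕ → R
  | 0 => 1
  | 1 => -a
  | j + 2 => -(r ⬝ᵥ (M ^ j).mulVec S)

theorem charpolyRev_border {n : Type*} [Fintype n] [DecidableEq n] (M : Matrix n n R) (S r : n → R)
    (a : R) :
    ((fromBlocks M (replicateCol Unit S) (replicateRow Unit r)
      (of fun _ _ : Unit => a)).charpolyRev : PowerSeries R) =
      (M.charpolyRev : PowerSeries R) * PowerSeries.mk (borderCoeff M S r a) := by
  set K : Matrix n n (PowerSeries R) :=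
    1 - (PowerSeries.X : PowerSeries R) • M.map (PowerSeries.C (R := R)) with hK
  have hunit : IsUnit K.det := by
    rw [← coe_charpolyRev, PowerSeries.isUnit_iff_constantCoeff]
    simp [Polynomial.coeff_zero_eq_eval_zero]
  let := K.invertibleOfIsUnitDet hunit
  set V : n → PowerSeries R := (⅟K).mulVec fun i => PowerSeries.C (S i) with hV
  have hKV : V = (fun i => PowerSeries.C (S i)) +
      (PowerSeries.X : PowerSeries R) • (M.map (PowerSeries.C (R := R))).mulVec V := by
    have : K.mulVec V = fun i => PowerSeries.C (S i) := by
      rw [hV, mulVec_mulVec, mul_invOf_self, one_mulVec]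
    rw [hK, sub_mulVec, one_mulVec, smul_mulVec] at this
    rw [← this, sub_add_cancel]
  have hcoeff : ∀ j i, PowerSeries.coeff j (V i) = (M ^ j).mulVec S i := by
    intro j
    induction j with
    | zero =>
      intro i
      rw [hKV]
      simp
    | succ j ih =>
      intro i
      rw [hKV]
      simp only [Pi.add_apply, Pi.smul_apply, map_add, smul_eq_mul, PowerSeries.coeff_succ_X_mul,
        PowerSeries.coeff_C, Nat.add_one_ne_zero, if_false, zero_add, pow_succ', ← mulVec_mulVec]
      simp [mulVec, dotProduct, ih]
  rw [coe_charpolyRev, coe_charpolyRev, ← fromBlocks_one]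
  have hblocks : (fromBlocks 1 0 0 1 - (PowerSeries.X : PowerSeries R) •
      (fromBlocks M (replicateCol Unit S) (replicateRow Unit r)
        (of fun _ _ : Unit => a)).map (PowerSeries.C (R := R))) =
      fromBlocks K (of fun i _ => -(PowerSeries.X * PowerSeries.C (S i)))
        (of fun _ i => -(PowerSeries.X * PowerSeries.C (r i)))
        (of fun _ _ => 1 - PowerSeries.X * PowerSeries.C a) := by
    ext i j : 1
    rcases i with i | i <;> rcases j with j | j <;> simp [hK, Matrix.one_apply]
  rw [hblocks, det_fromBlocks₁₁]
  congr 1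
  rw [det_unique]
  have hW : ((⅟K) * of fun i (_ : Unit) => -(PowerSeries.X * PowerSeries.C (S i))) =
      of fun i _ => -(PowerSeries.X * V i) := by
    ext i j : 1
    simp [Matrix.mul_apply, hV, mulVec, dotProduct, Finset.mul_sum, mul_left_comm]
  rw [Matrix.mul_assoc, hW]
  ext j
  rcases j with _ | _ | j
  · simp [borderCoeff, Matrix.mul_apply, mul_assoc]
  · simp [borderCoeff, Matrix.mul_apply, mul_assoc, PowerSeries.coeff_one]
  · simp [borderCoeff, Matrix.mul_apply, mul_assoc, PowerSeries.coeff_one,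
      mul_left_comm _ PowerSeries.X, PowerSeries.coeff_succ_X_mul, hcoeff, dotProduct, PowerSeries.coeff_X]

theorem list_ofFn_rev_prod_mulVec {k : Type*} [Fintype k] [DecidableEq k] {m : ℕ}
    (T : Fin m → Matrix k k R) (c : ℕ → k → R) (h : ∀ t : Fin m, (T t).mulVec (c t) = c (t + 1)) :
    (List.ofFn fun t : Fin m => T t.rev).prod.mulVec (c 0) = c m := by
  induction m with
  | zero => simp
  | succ m ih =>
    rw [List.ofFn_succ, List.prod_cons, ← mulVec_mulVec]
    simp only [Fin.rev_succ, Fin.rev_zero]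
    rw [ih (fun t => T t.castSucc) fun t => h t.castSucc]
    exact h (Fin.last m)

/-- The leading principal submatrix of any size `t ≤ m`. -/
def leadingLE {m : ℕ} (A : Matrix (Fin m) (Fin m) R) (t : ℕ) (ht : t ≤ m) :
    Matrix (Fin t) (Fin t) R :=
  A.submatrix (Fin.castLE ht) (Fin.castLE ht)

theorem charpolyRev_leadingLE_succ {m : ℕ} (A : Matrix (Fin m) (Fin m) R) (t : Fin m) :
    ((leadingLE A (t + 1) t.2).charpolyRev : PowerSeries R) =
      ((leadingLE A t t.2.le).charpolyRev : PowerSeries R) * PowerSeries.mk (sbCoeff A t) := by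
  let e : Fin (t : ℕ) ⊕ Unit ≃ Fin (t + 1) :=
    (Equiv.sumCongr (Equiv.refl _) (Equiv.ofUnique Unit (Fin 1))).trans finSumFinEquiv
  have hq : sbCoeff A t = borderCoeff (leadingLE A t t.2.le)
      (fun k => A (Fin.castLE t.2.le k) t) (fun k => A t (Fin.castLE t.2.le k)) (A t t) := by
    funext j
    rcases j with _ | _ | j <;> rfl
  rw [hq, ← charpolyRev_border, ← charpolyRev_reindex e]
  congr 2
  ext i j
  obtain ⟨i, rfl⟩ := e.surjective i
  obtain ⟨j, rfl⟩ := e.surjective j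
  rw [reindex_apply, submatrix_apply, Equiv.symm_apply_apply, Equiv.symm_apply_apply]
  rcases i with i | i <;> rcases j with j | j <;> rfl

theorem toeplitz_mulVec {m : ℕ} (A : Matrix (Fin m) (Fin m) R) (t : Fin m) :
    (toeplitz (fun t (j : Fin (m + 1)) => sbCoeff A t j) t).mulVec
      (fun i => (leadingLE A t t.2.le).charpolyRev.coeff i) =
      fun i : Fin (m + 1) => (leadingLE A (t + 1) t.2).charpolyRev.coeff i := by
  funext i
  have hentry : ∀ j : Fin (m + 1),
      toeplitz (fun t (j : Fin (m + 1)) => sbCoeff A t j) t i j *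
        (leadingLE A t t.2.le).charpolyRev.coeff j =
      (fun k : ℕ => if k ≤ i ∧ (i : ℕ) ≤ t + 1 then
        (leadingLE A t t.2.le).charpolyRev.coeff k * sbCoeff A t (i - k) else 0) j := by
    intro j
    by_cases hj : (j : ℕ) ≤ t
    · by_cases hji : j ≤ i
      · simp [toeplitz, hj, hji, Fin.coe_sub_iff_le.2 hji, mul_comm]
      · simp [toeplitz, hji]
    · simp [coeff_charpolyRev_of_lt (leadingLE A t t.2.le) (i := j) (by simpa using hj)]
  rw [mulVec, dotProduct, Finset.sum_congr rfl fun j _ => hentry j,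
    Fin.sum_univ_eq_sum_range (fun k : ℕ => if k ≤ i ∧ (i : ℕ) ≤ t + 1 then
        (leadingLE A t t.2.le).charpolyRev.coeff k * sbCoeff A t (i - k) else 0)]
  by_cases hi : (i : ℕ) ≤ t + 1
  · rw [← Polynomial.coeff_coe (leadingLE A (t + 1) t.2).charpolyRev, charpolyRev_leadingLE_succ,
      PowerSeries.coeff_mul, Finset.Nat.sum_antidiagonal_eq_sum_range_succ_mk,
      ← Finset.sum_subset (Finset.range_subset_range.2 (Nat.succ_le_of_lt i.2)) fun k _ hk =>
        if_neg fun h => hk (Finset.mem_range.2 (Nat.lt_succ_of_le h.1))]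
    exact Finset.sum_congr rfl fun k hk => by
      simp [hi, Nat.le_of_lt_succ (Finset.mem_range.1 hk)]
  · rw [coeff_charpolyRev_of_lt _ (by simpa using hi)]
    simp [hi]

theorem sbDet_eq_det {m : ℕ} (A : Matrix (Fin m) (Fin m) R) : sbDet A = A.det := by
  have h := list_ofFn_rev_prod_mulVec
    (fun t => toeplitz (fun t (j : Fin (m + 1)) => sbCoeff A t j) t)
    (fun t i => if ht : t ≤ m then (leadingLE A t ht).charpolyRev.coeff i else 0) fun t => by
      simpa [t.2.le, Nat.succ_le_of_lt t.2] using toeplitz_mulVec A t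
  have h0 : (fun i : Fin (m + 1) => if ht : 0 ≤ m then
      (leadingLE A 0 ht).charpolyRev.coeff i else 0) = Pi.single 0 1 := by
    funext i
    rw [dif_pos m.zero_le, charpolyRev, det_isEmpty, Polynomial.coeff_one]
    rw [Pi.single_apply]
    exact if_congr (by rw [Fin.ext_iff, Fin.val_zero]) rfl rfl
  rw [h0, mulVec_single_one] at h
  have hm := congrFun h (Fin.last m)
  have hA : leadingLE A m le_rfl = A := rfl
  have hc := coeff_charpolyRev_card A
  rw [Fintype.card_fin] at hc
  simp only [le_refl, dite_true, hA, Fin.val_last, hc, col_apply] at hm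
  rw [sbDet, sbProduct, hm, ← mul_assoc, ← mul_pow]
  simp

end Determinant

/-! ### Arithmetic circuits for the Samuelson–Berkowitz algorithm -/

section Padding

variable {R : Type*} [CommRing R] {m : ℕ}

/-- The leading principal submatrix of size `t`, padded by zeros. -/
def padded (A : Matrix (Fin m) (Fin m) R) (t : Fin m) : Matrix (Fin m) (Fin m) R :=
  fun r c => if r < t ∧ c < t then A r c else 0

theorem sum_castLE {M : Type*} [AddCommMonoid M] (t : Fin m) (f : Fin m → M) :
    ∑ k, (if k < t then f k else 0) = ∑ k : Fin (t : ℕ), f (Fin.castLE t.2.le k) := by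
  refine (Fintype.sum_of_injective _ (Fin.castLE_injective t.2.le) _ _ (fun k hk => ?_)
    fun k => ?_).symm
  · exact if_neg fun h => hk ⟨⟨k, h⟩, rfl⟩
  · exact (if_pos k.2).symm

theorem padded_pow_castLE (A : Matrix (Fin m) (Fin m) R) (t : Fin m) (j : ℕ) (r c : Fin (t : ℕ)) :
    (padded A t ^ j) (Fin.castLE t.2.le r) (Fin.castLE t.2.le c) = (leading A t ^ j) r c := by
  induction j generalizing r with
  | zero => simp [Matrix.one_apply, Fin.ext_iff]
  | succ j ih =>
    rw [pow_succ', pow_succ', Matrix.mul_apply, Matrix.mul_apply]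
    simp only [← ih]
    refine Eq.trans ?_ (sum_castLE t fun k =>
      A (Fin.castLE t.2.le r) k * (padded A t ^ j) k (Fin.castLE t.2.le c))
    have hr : Fin.castLE t.2.le r < t := r.2
    simp [padded, hr]

theorem dotProduct_leading_pow (A : Matrix (Fin m) (Fin m) R) (t : Fin m) (j : ℕ) :
    (fun k => A t (Fin.castLE t.2.le k)) ⬝ᵥ
      ((leading A t ^ j).mulVec fun k => A (Fin.castLE t.2.le k) t) =
      ∑ i : Fin m × Fin m, if i.1 < t ∧ i.2 < t then
        A t i.1 * ((padded A t ^ j) i.1 i.2 * A i.2 t) else 0 := by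
  simp only [Fintype.sum_prod_type, ite_and, dotProduct, Matrix.mulVec, ← padded_pow_castLE]
  rw [← sum_castLE t fun r => A t r *
    ∑ c : Fin (t : ℕ), (padded A t ^ j) r (Fin.castLE t.2.le c) * A (Fin.castLE t.2.le c) t]
  refine Finset.sum_congr rfl fun r _ => ?_
  split_ifs
  · rw [← sum_castLE t fun c => (padded A t ^ j) r c * A c t, Finset.mul_sum]
    simp [mul_ite]
  · simp

theorem sbCoeff_eq (A : Matrix (Fin m) (Fin m) R) (t : Fin m) (j : ℕ) :
    sbCoeff A t j = if j = 0 then 1 else if j = 1 then -1 * A t t else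
      -1 * ∑ i : Fin m × Fin m, if i.1 < t ∧ i.2 < t then
        A t i.1 * ((padded A t ^ (j - 2)) i.1 i.2 * A i.2 t) else 0 := by
  rcases j with _ | _ | j
  · simp [sbCoeff]
  · simp [sbCoeff]
  · simp [sbCoeff, dotProduct_leading_pow]

theorem list_range_prod_eq_pow {M : Type*} [Monoid M] (b : M) {e L : ℕ} (h : e ≤ L) :
    ((List.range L).map fun s => if s < e then b else 1).prod = b ^ e := by
  obtain ⟨k, rfl⟩ := Nat.exists_eq_add_of_le h
  rw [List.range_add, List.map_append, List.prod_append, List.map_map,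
    List.prod_eq_one (l := List.map _ (List.range k)) fun x hx => by
      obtain ⟨s, -, rfl⟩ := List.mem_map.1 hx
      simp, mul_one,
    List.map_congr_left (g := fun _ => b) fun s hs => if_pos (List.mem_range.1 hs)]
  simp

theorem list_ofFn_eq_map_range {α : Type*} {L : ℕ} (f : Fin L → α) (b : α) :
    List.ofFn f = (List.range L).map fun s => if h : s < L then f ⟨s, h⟩ else b := by
  apply List.ext_getElem <;> simp +contextual

end Padding

namespace NC

variable {P : Type} [Sized P] {A : P → Type*} {R : ∀ p, A p → Type} [∀ p a, CommRing (R p a)]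
    {ι κ : P → Type} {x : ∀ p (a : A p), ι p → R p a} [∀ p, Fintype (κ p)] {m : P → ℕ}

theorem phase₁ (hκ : Poly fun p => Fintype.card (κ p)) (hm : Poly m)
    {B : ∀ p (a : A p), κ p → Matrix (Fin (m p)) (Fin (m p)) (R p a)}
    (h : NC x fun p a (j : κ p × Fin (m p) × Fin (m p)) => B p a j.1 j.2.1 j.2.2) :
    NC x fun p a (j : κ p × Fin (m p) × Fin (m p + 1)) => sbCoeff (B p a j.1) j.2.1 j.2.2 := by
  have hF : Poly fun p => Fintype.card (Fin (m p)) := by simpa using hm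
  have hF' : Poly fun p => Fintype.card (Fin (m p + 1)) := by simpa using hm.add (.const 1)
  have ho := card_prod hκ (card_prod hF hF')
  have hpow : NC x fun p a (j : (κ p × Fin (m p) × Fin (m p + 1)) × Fin (m p) × Fin (m p)) =>
      (padded (B p a j.1.1) j.1.2.1 ^ (j.1.2.2 : ℕ)) j.2.1 j.2.2 := by
    refine (matrixListProd ho hF hm
      (v := fun p a (i : κ p × Fin (m p) × Fin (m p + 1)) s =>
        if s < (i.2.2 : ℕ) then padded (B p a i.1) i.2.1 else 1)
      ((ite (fun p (j : ((κ p × Fin (m p) × Fin (m p + 1)) × Fin (m p)) × Fin (m p) × Fin (m p)) =>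
          (j.1.2 : ℕ) < j.1.1.2.2)
        (ite (fun p j => j.2.1 < j.1.1.2.1 ∧ j.2.2 < j.1.1.2.1)
          (h.reindex fun p j => (j.1.1.1, j.2)) (zero x))
        (ite (fun p j => j.2.1 = j.2.2) (one x) (zero x))).congr fun p a j => ?_)).congr
      fun p a j => ?_
    · by_cases hj : (j.1.2 : ℕ) < j.1.1.2.2 <;> simp [hj, padded, Matrix.one_apply]
    · rw [list_range_prod_eq_pow _ (Nat.le_of_lt_succ j.1.2.2.2)]
  refine (ite (fun p (j : κ p × Fin (m p) × Fin (m p + 1)) => (j.2.2 : ℕ) = 0) (one x)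
    (ite (fun p j => (j.2.2 : ℕ) = 1)
      (mul ho (negOne x) (h.reindex fun p j => (j.1, j.2.1, j.2.1)))
      (mul ho (negOne x) (sum (K := fun p => Fin (m p) × Fin (m p)) ho (card_prod hF hF)
        (ite (fun p j => j.2.1 < j.1.2.1 ∧ j.2.2 < j.1.2.1)
          (mul (card_prod ho (card_prod hF hF))
            (h.reindex fun p j => (j.1.1, j.1.2.1, j.2.1))
            (mul (card_prod ho (card_prod hF hF))
              (hpow.reindex fun p j =>
                ((j.1.1, j.1.2.1, ⟨j.1.2.2 - 2, by have := j.1.2.2.2; omega⟩), j.2))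
              (h.reindex fun p j => (j.1.1, j.2.2, j.1.2.1))))
          (zero x)))))).congr fun p a j => ?_
  rw [sbCoeff_eq]

theorem phase₂ (hκ : Poly fun p => Fintype.card (κ p)) (hm : Poly m)
    {q : ∀ p (a : A p), κ p → Fin (m p) → Fin (m p + 1) → R p a}
    (h : NC x fun p a (j : κ p × Fin (m p) × Fin (m p + 1)) => q p a j.1 j.2.1 j.2.2) :
    NC x fun p a k => sbProduct (q p a k) := by
  have hF' : Poly fun p => Fintype.card (Fin (m p + 1)) := by simpa using hm.add (.const 1)
  have hprod := matrixListProd hκ hF' hm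
    (v := fun p a k s => if h : s < m p then toeplitz (q p a k) (Fin.rev ⟨s, h⟩) else 1)
    ((ite (fun p (j : (κ p × Fin (m p)) × Fin (m p + 1) × Fin (m p + 1)) =>
        j.2.2 ≤ j.2.1 ∧ (j.2.2 : ℕ) ≤ j.1.2.rev ∧ (j.2.1 : ℕ) ≤ j.1.2.rev + 1)
      (h.reindex fun p j => (j.1.1, j.1.2.rev, j.2.1 - j.2.2)) (zero x)).congr fun p a j => by
        rw [dif_pos j.1.2.2, toeplitz])
  refine (mul hκ (ite (fun p _ => Even (m p)) (one x) (negOne x))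
    (hprod.reindex fun p k => (k, Fin.last _, 0))).congr fun p a k => ?_
  rw [sbProduct, list_ofFn_eq_map_range _ 1]
  rcases (m p).even_or_odd with hm | hm
  · simp [hm]
  · simp [hm.neg_one_pow, Nat.not_even_iff_odd.2 hm]

end NC

/-- The size of the problem for an `n × n` matrix is `n + 2`. -/
@[reducible]
def sizedDim : Sized ℕ where
  size n := n + 2
  two_le_size n := Nat.le_add_left 2 n

section Phases

variable {ι κ : ℕ → Type} [∀ n, Fintype (κ n)] {m : ℕ → ℕ}

theorem exists_phase₁ (hκ : PolyBounded (fun n => n + 2) fun n => Fintype.card (κ n))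
    (hm : PolyBounded (fun n => n + 2) m) (sub : ∀ n, κ n → Fin (m n) → Fin (m n) → ι n) :
    ∃ c, ∀ n, ∃ C : Circuit (ι n) (κ n × Fin (m n) × Fin (m n + 1)),
      C.Polylog c (n + 2) ∧ ExecutesPhase₁ C (sub n) := by
  let := sizedDim
  have := NC.phase₁ (A := fun n => (R : CommRingCat.{0}) × (ι n → R)) (R := fun _ a => a.1)
    (x := fun _ a => a.2) hκ hm (B := fun n a k => Matrix.of fun r c => a.2 (sub n k r c))
    (NC.input _ fun n (j : κ n × Fin (m n) × Fin (m n)) => sub n j.1 j.2.1 j.2.2)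
  refine this.exists_polylog.imp fun c h n => (h n).imp fun C hC => ⟨hC.1, ?_⟩
  exact fun R _ x k t j => congrFun (hC.2 ⟨CommRingCat.of R, x⟩) (k, t, j)

theorem exists_phase₂ (hκ : PolyBounded (fun n => n + 2) fun n => Fintype.card (κ n))
    (hm : PolyBounded (fun n => n + 2) m) :
    ∃ c, ∀ n, ∃ C : Circuit (κ n × Fin (m n) × Fin (m n + 1)) (κ n),
      C.Polylog c (n + 2) ∧ ExecutesPhase₂ C := by
  let := sizedDim
  have := NC.phase₂ (A := fun n => (R : CommRingCat.{0}) × (κ n × Fin (m n) × Fin (m n + 1) → R))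
    (R := fun _ a => a.1) (x := fun _ a => a.2) hκ hm (q := fun n a k t j => a.2 (k, t, j))
    (NC.refl _)
  refine this.exists_polylog.imp fun c h n => (h n).imp fun C hC => ⟨hC.1, ?_⟩
  exact fun R _ x k => congrFun (hC.2 ⟨CommRingCat.of R, x⟩) k

end Phases

/-! ### Bit strings of truncated polynomials -/

/-- The identification of `𝔽₂` with the ring of bits. -/
def toBit : ZMod 2 →+* Bool where
  toFun c := decide (c = 1)
  map_zero' := by decide
  map_one' := by decide
  map_add' := by decide
  map_mul' := by decide

namespace Trunc

variable {d : ℕ}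

theorem coeff_mk (f : (ZMod 2)[X]) (k : ℕ) :
    coeff (AdjoinRoot.mk ((Polynomial.X : (ZMod 2)[X]) ^ d) f) k =
      if k < d then f.coeff k else 0 := by
  rw [coeff, AdjoinRoot.modByMonicHom_mk]
  split_ifs with h
  · conv_rhs => rw [← modByMonic_add_div f ((Polynomial.X : (ZMod 2)[X]) ^ d), coeff_add,
      coeff_X_pow_mul', if_neg (by omega), add_zero]
  · refine coeff_eq_zero_of_degree_lt ((degree_modByMonic_lt f (monic_X_pow d)).trans_le ?_)
    rw [degree_X_pow]
    exact_mod_cast not_lt.1 h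

theorem coeff_of_le (p : Trunc d) {k : ℕ} (hk : d ≤ k) : p.coeff k = 0 := by
  obtain ⟨f, rfl⟩ := AdjoinRoot.mk_surjective p
  rw [coeff_mk, if_neg (not_lt.2 hk)]

theorem bit_eq (p : Trunc d) (k : Fin d) : p.bit k = toBit (p.coeff k) := rfl

theorem bit_zero (k : Fin d) : (0 : Trunc d).bit k = 0 := by
  rw [← map_zero (AdjoinRoot.mk _), bit_eq, coeff_mk]
  simp

theorem bit_X_pow (e : ℕ) (k : Fin d) : (Trunc.X d ^ e).bit k = if (k : ℕ) = e then 1 else 0 := by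
  rw [Trunc.X, ← AdjoinRoot.mk_X, ← map_pow, bit_eq, coeff_mk, if_pos k.2, coeff_X_pow]
  split_ifs <;> simp

theorem bit_one (k : Fin d) : (1 : Trunc d).bit k = if (k : ℕ) = 0 then 1 else 0 := by
  rw [← pow_zero (Trunc.X d), bit_X_pow]

theorem neg_eq (p : Trunc d) : -p = p := by
  obtain ⟨f, rfl⟩ := AdjoinRoot.mk_surjective p
  rw [← map_neg, CharTwo.neg_eq]

theorem bit_add (p q : Trunc d) (k : Fin d) : (p + q).bit k = p.bit k + q.bit k := by
  simp [bit_eq, coeff]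

theorem bit_mul (p q : Trunc d) (k : Fin d) : (p * q).bit k =
    ∑ i : Fin d, if i ≤ k then p.bit i * q.bit ⟨k - i, by omega⟩ else 0 := by
  obtain ⟨f, rfl⟩ := AdjoinRoot.mk_surjective p
  obtain ⟨g, rfl⟩ := AdjoinRoot.mk_surjective q
  rw [← map_mul, bit_eq, coeff_mk, if_pos k.2, coeff_mul,
    Finset.Nat.sum_antidiagonal_eq_sum_range_succ_mk, map_sum]
  have : ∀ i : Fin d, (if i ≤ k then
      Trunc.bit (d := d) (AdjoinRoot.mk _ f) i *
        Trunc.bit (d := d) (AdjoinRoot.mk _ g) ⟨k - i, by omega⟩ else 0) =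
      (fun i : ℕ => if i ≤ k then toBit (f.coeff i * g.coeff (k - i)) else 0) i := by
    intro i
    have h : (k : ℕ) - i < d := by omega
    simp [bit_eq, coeff_mk, h]
  rw [Finset.sum_congr rfl fun i _ => this i,
    Fin.sum_univ_eq_sum_range (fun i : ℕ => if i ≤ k then toBit (f.coeff i * g.coeff (k - i)) else 0),
    ← Finset.sum_subset (Finset.range_subset_range.2 (Nat.succ_le_of_lt k.2)) fun i _ hi =>
        if_neg fun h => hi (Finset.mem_range.2 (Nat.lt_succ_of_le h))]
  exact Finset.sum_congr rfl fun i hi => by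
    rw [if_pos (Nat.le_of_lt_succ (Finset.mem_range.1 hi))]

end Trunc

/-! ### Execution of arithmetic circuits over truncated polynomials -/

namespace NC

variable {P : Type} [Sized P] {A : P → Type*} {ι κ : P → Type} {x : ∀ p, A p → ι p → Bool}
  {d : P → ℕ} [∀ p, Fintype (κ p)]

theorem poly_fin {f : P → ℕ} (hf : Poly f) : Poly fun p => Fintype.card (Fin (f p)) := by
  simpa using hf

theorem truncMul (hκ : Poly fun p => Fintype.card (κ p)) (hd : Poly d)
    {u v : ∀ p, A p → κ p → Trunc (d p)} (hu : NC x fun p a => bits (u p a))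
    (hv : NC x fun p a => bits (v p a)) : NC x fun p a => bits fun k => u p a k * v p a k := by
  have ho := card_prod hκ (poly_fin hd)
  refine (sum (K := fun p => Fin (d p)) ho (poly_fin hd)
    (ite (fun p (j : (κ p × Fin (d p)) × Fin (d p)) => j.2 ≤ j.1.2)
      (mul (card_prod ho (poly_fin hd)) (hu.reindex fun p j => (j.1.1, j.2))
        (hv.reindex fun p j => (j.1.1, ⟨j.1.2 - j.2, by have := j.1.2.2; omega⟩)))
      (zero x))).congr fun p a j => ?_
  exact (Trunc.bit_mul (u p a j.1) (v p a j.1) j.2).symm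

end NC

/-- The bits on a wire, from a table with the bits of all inputs and all gate results. -/
def wireBit {ι γ : Type} {d : ℕ} (u : Wire ι γ) (k : Fin d) : Wire ((ι ⊕ γ) × Fin d) Empty :=
  match u with
  | .zero => .zero
  | .one => if (k : ℕ) = 0 then .one else .zero
  | .negOne => if (k : ℕ) = 0 then .one else .zero
  | .input i => .input (.inl i, k)
  | .gate g => .input (.inr g, k)

theorem val_wireBit {ι γ : Type} {d : ℕ} (u : Wire ι γ) (k : Fin d) (x : ι → Trunc d)
    (v : γ → Trunc d) :
    (wireBit u k).val (bits (Sum.elim x v)) Empty.elim = (u.val x v).bit k := by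
  cases u with
  | zero => exact (Trunc.bit_zero k).symm
  | one => rw [Wire.val, Trunc.bit_one, wireBit]; split_ifs <;> rfl
  | negOne => rw [Wire.val, Trunc.neg_eq, Trunc.bit_one, wireBit]; split_ifs <;> rfl
  | input i => rfl
  | gate g => rfl

namespace Circuit

variable {ι o : Type} {R : Type*} [CommRing R]

/-- The results of the gates after `r` time steps. -/
def table (C : Circuit ι o) (x : ι → R) (r : ℕ) (g : C.Gate) : R :=
  if C.time g < r then C.gateVal x g else 0

theorem table_succ (C : Circuit ι o) (x : ι → R) (r : ℕ) (g : C.Gate) :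
    C.table x (r + 1) g = if C.time g < r + 1 then
      (C.op g).run ((C.left g).val x (C.table x r)) ((C.right g).val x (C.table x r)) else 0 := by
  rw [table]
  split_ifs with hg
  · rw [gateVal_eq]
    congr 1
    · refine Wire.val_congr fun h hh => (if_pos ?_).symm
      exact (C.left_lt g h hh).trans_le (Nat.le_of_lt_succ hg)
    · refine Wire.val_congr fun h hh => (if_pos ?_).symm
      exact (C.right_lt g h hh).trans_le (Nat.le_of_lt_succ hg)
  · rfl

theorem table_depth (C : Circuit ι o) (x : ι → R) : C.table x C.depth = C.gateVal x :=
  funext fun g => if_pos (C.time_lt_depth g)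

end Circuit

section Realization

variable {P : Type} [Sized P] {ι o : P → Type} {d : P → ℕ}

theorem NC.wireBits {P : Type} [Sized P] {A : P → Type*} {ι γ κ : P → Type} {d : P → ℕ}
    (u : ∀ p, κ p → Wire (ι p) (γ p)) (x : ∀ p, A p → ι p → Trunc (d p))
    (v : ∀ p, A p → γ p → Trunc (d p)) :
    NC (fun p a => bits (Sum.elim (x p a) (v p a)))
      fun p a => bits fun k => (u p k).val (x p a) (v p a) :=
  (NC.wire _ fun p (j : κ p × Fin (d p)) => wireBit (u p j.1) j.2).congr
    fun _ _ _ => val_wireBit _ _ _ _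

theorem NC.gateBits (C : ∀ p, Circuit (ι p) (o p))
    (hT : Polylog fun p => (C p).depth) (hS : Poly fun p => (C p).size) (hd : Poly d) :
    NC (fun p (a : ι p → Trunc (d p)) => bits a)
      fun p a => bits (Sum.elim a ((C p).gateVal a)) := by
  let _ : ∀ p, Fintype (C p).Gate := fun p => (C p).finite
  have hS' : Poly fun q : P × ℕ => Fintype.card (C q.1).Gate := Poly.lift hS
  have hSd := NC.card_prod hS' (NC.poly_fin hd.lift)
  have step : NC (P := P × ℕ) (A := fun q => ι q.1 → Trunc (d q.1))
      (fun q a => bits (Sum.elim a ((C q.1).table a q.2)))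
      fun q a => bits (Sum.elim a ((C q.1).table a (q.2 + 1))) := by
    have hl := NC.wireBits (P := P × ℕ) (A := fun q => ι q.1 → Trunc (d q.1))
      (fun q => (C q.1).left) (fun q a => a) fun q a => (C q.1).table a q.2
    have hr := NC.wireBits (P := P × ℕ) (A := fun q => ι q.1 → Trunc (d q.1))
      (fun q => (C q.1).right) (fun q a => a) fun q a => (C q.1).table a q.2
    have hgate : NC (P := P × ℕ) (A := fun q => ι q.1 → Trunc (d q.1))
        (fun q a => bits (Sum.elim a ((C q.1).table a q.2)))
        fun q a => bits ((C q.1).table a (q.2 + 1)) := by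
      classical
      refine (NC.ite (fun (q : P × ℕ) (j : (C q.1).Gate × Fin (d q.1)) => (C q.1).time j.1 < q.2 + 1)
        (NC.ite (fun q j => (C q.1).op j.1 = .add) (NC.add hSd hl hr)
          (NC.truncMul hS' hd.lift hl hr)) (NC.zero _)).congr fun q a j => ?_
      simp only [bits, Circuit.table_succ]
      split_ifs with h1 h2
      · rw [h2]
        exact (Trunc.bit_add _ _ _).symm
      · rw [show (C q.1).op j.1 = .mul by cases h : (C q.1).op j.1 <;> simp_all]
        rfl
      · exact (Trunc.bit_zero _).symm
    exact (((NC.input _ fun (q : P × ℕ) (j : ι q.1 × Fin (d q.1)) => (.inl j.1, j.2)).pair hgate).reindex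
      fun q (j : (ι q.1 ⊕ (C q.1).Gate) × Fin (d q.1)) =>
        j.1.elim (fun i => .inl (i, j.2)) fun g => .inr (g, j.2)).congr fun q a j => by
        obtain ⟨i | i, k⟩ := j <;> rfl
  have h0 : NC (fun p (a : ι p → Trunc (d p)) => bits a)
      fun p a => bits (Sum.elim a ((C p).table a 0)) :=
    (NC.wire _ fun p (j : (ι p ⊕ (C p).Gate) × Fin (d p)) =>
      j.1.elim (fun i => .input (i, j.2)) fun _ => .zero).congr fun p a j => by
        obtain ⟨i | i, k⟩ := j
        · rfl
        · exact (Trunc.bit_zero _).symm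
  refine (h0.trans (NC.iterate (fun p r a => bits (Sum.elim a ((C p).table a r))) _ hT step)).congr
    fun p a j => ?_
  rw [Circuit.table_depth]

theorem exists_realizes (C : ∀ p, Circuit (ι p) (o p)) {c : ℕ}
    (hC : ∀ p, (C p).Polylog c (Sized.size p)) (hd : Poly d) :
    ∃ c, ∀ p, ∃ Q : Circuit (ι p × Fin (d p)) (o p × Fin (d p)),
      Q.Polylog c (Sized.size p) ∧ Realizes (d p) Q (C p) := by
  have hgates := NC.gateBits C ⟨c, fun p => (hC p).1⟩ ⟨c, fun p => (hC p).2⟩ hd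
  have hout := hgates.trans (NC.wireBits (fun p => Sum.elim .gate (C p).out) (fun p a => a)
    fun p a => (C p).gateVal a)
  obtain ⟨c, h⟩ := hout.exists_polylog
  refine ⟨c, fun p => ?_⟩
  obtain ⟨Q, ⟨hT, hS⟩, hQ⟩ := h p
  let E : Circuit (ι p × Fin (d p)) (o p × Fin (d p)) :=
    Q.extend (.wiring Empty.elim) Empty.elim fun j =>
      (Q.out (.inr j.1, j.2)).bind .input fun h => .gate (.inl h)
  refine ⟨E, ⟨(Q.depth_extend_le _ _ _).trans (by simpa [Circuit.depth_wiring] using hT),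
    (Q.size_extend _ _ _).trans_le (by simpa [Circuit.size_wiring] using hS)⟩,
    fun g k => (Q.out (.inl g, k)).bind .input fun h => .gate (.inl h), fun x => ⟨fun g k => ?_, ?_⟩⟩
  · exact (Q.wireVal_extend_inl _ _ _ _ _).trans (congrFun (hQ x) (.inl g, k))
  · funext j
    exact (Q.wireVal_extend_inl _ _ _ _ _).trans (congrFun (hQ x) (.inr j.1, j.2))

end Realization

/-! ### Binary arithmetic -/

section TwosComplement

theorem testBit_eq_decide (x : ℤ) (k : ℕ) : x.testBit k = decide (x / 2 ^ k % 2 = 1) := by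
  cases x with
  | ofNat m =>
    rw [Int.testBit, Nat.testBit_eq_decide_div_mod_eq]
    exact decide_eq_decide.2 (by rw [Int.ofNat_eq_natCast]; norm_cast)
  | negSucc m =>
    rw [Int.testBit, Nat.testBit_eq_decide_div_mod_eq]
    have : Int.negSucc m / 2 ^ k = -((m / 2 ^ k : ℕ) : ℤ) - 1 := by
      rw [Int.negSucc_ediv _ (by positivity), Int.natCast_ediv, Nat.cast_pow, Nat.cast_ofNat, neg_add']
      rfl
    rw [this, ← decide_not]
    exact decide_eq_decide.2 (by omega)

theorem testBit_zero (k : ℕ) : (0 : ℤ).testBit k = false := Nat.zero_testBit k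

theorem testBit_mul_two_pow (x : ℤ) (s k : ℕ) :
    (x * 2 ^ s).testBit k = if k < s then false else x.testBit (k - s) := by
  rw [testBit_eq_decide, testBit_eq_decide]
  split_ifs with h
  · obtain ⟨e, rfl⟩ := Nat.exists_eq_add_of_lt h
    rw [show x * 2 ^ (k + e + 1) = 2 ^ k * (2 * (x * 2 ^ e)) by ring,
      Int.mul_ediv_cancel_left _ (by positivity), Int.mul_emod_right]
    rfl
  · obtain ⟨e, rfl⟩ := Nat.exists_eq_add_of_le (not_lt.1 h)
    rw [mul_comm, pow_add, Int.mul_ediv_mul_of_pos _ _ (by positivity), Nat.add_sub_cancel_left]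

theorem testBit_of_le {x : ℤ} {b k : ℕ} (h1 : -2 ^ b ≤ x) (h2 : x < 2 ^ b) (hk : b ≤ k) :
    x.testBit k = decide (x < 0) := by
  rw [testBit_eq_decide]
  have hpow : (2 : ℤ) ^ b ≤ 2 ^ k := pow_le_pow_right₀ one_le_two hk
  apply decide_eq_decide.2
  rcases lt_or_ge x 0 with hx | hx
  · rw [show x / 2 ^ k = -1 from (Int.ediv_eq_iff_of_pos (by positivity)).2 ⟨by linarith, by linarith⟩]
    simp [hx]
  · rw [Int.ediv_eq_zero_of_lt hx (h2.trans_le hpow)]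
    simp [hx]

/-- Addition with carries. -/
theorem exists_carry (x y : ℤ) : ∃ c : ℕ → Bool, c 0 = 0 ∧
    (∀ k, c (k + 1) = x.testBit k * y.testBit k + (x.testBit k + y.testBit k) * c k) ∧
    ∀ k, (x + y).testBit k = x.testBit k + y.testBit k + c k := by
  refine ⟨fun k => decide ((x + y) / 2 ^ k - x / 2 ^ k - y / 2 ^ k = 1), by simp; rfl, ?_⟩
  have h01 : ∀ k, (x + y) / 2 ^ k - x / 2 ^ k - y / 2 ^ k = 0 ∨
      (x + y) / 2 ^ k - x / 2 ^ k - y / 2 ^ k = 1 := by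
    intro k
    induction k with
    | zero => simp
    | succ k ih =>
      simp only [pow_succ, ← Int.ediv_ediv_of_nonneg (show (0 : ℤ) ≤ 2 ^ k by positivity)]
      omega
  refine ⟨fun k => ?_, fun k => ?_⟩
  · simp only [testBit_eq_decide]
    have := h01 k
    simp only [pow_succ, ← Int.ediv_ediv_of_nonneg (show (0 : ℤ) ≤ 2 ^ k by positivity)]
    generalize (x + y) / 2 ^ k = Z at *
    generalize x / 2 ^ k = X at *
    generalize y / 2 ^ k = Y at *
    rcases Int.emod_two_eq_zero_or_one X with hX | hX <;>
    rcases Int.emod_two_eq_zero_or_one Y with hY | hY <;>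
    rcases this with hZ | hZ <;> by_cases hq : Z / 2 - X / 2 - Y / 2 = 1 <;>
    simp only [hX, hY, hZ, hq] <;> first | (exfalso; omega) | decide
  · simp only [testBit_eq_decide]
    have := h01 k
    generalize (x + y) / 2 ^ k = Z at *
    generalize x / 2 ^ k = X at *
    generalize y / 2 ^ k = Y at *
    rcases Int.emod_two_eq_zero_or_one X with hX | hX <;>
    rcases Int.emod_two_eq_zero_or_one Y with hY | hY <;>
    rcases this with hZ | hZ <;> by_cases hq : Z % 2 = 1 <;>
    simp only [hX, hY, hZ, hq] <;> first | (exfalso; omega) | decide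

/-- The solution of the recursion for the carries. -/
theorem carry_eq {R : Type*} [CommRing R] {L : ℕ} {g p c : ℕ → R} (h0 : c 0 = 0)
    (hc : ∀ k, c (k + 1) = g k + p k * c k) {k : ℕ} (hk : k ≤ L) :
    c k = ∑ j : Fin L, if (j : ℕ) < k then
      g j * ∏ i : Fin L, (if j < i ∧ (i : ℕ) < k then p i else 1) else 0 := by
  induction k with
  | zero => simp [h0]
  | succ k ih =>
    have hprod : ∀ j : Fin L, (∏ i : Fin L, if j < i ∧ (i : ℕ) < k + 1 then p i else 1) =
        (if (j : ℕ) < k then p k else 1) *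
          ∏ i : Fin L, (if j < i ∧ (i : ℕ) < k then p i else 1) := by
      intro j
      rw [show (if (j : ℕ) < k then p k else 1) =
          ∏ i : Fin L, if (⟨k, hk⟩ : Fin L) = i then (if j < i then p i else 1) else 1 by
        rw [Fintype.prod_ite_eq]; rfl, ← Finset.prod_mul_distrib]
      refine Finset.prod_congr rfl fun i _ => ?_
      simp only [Fin.ext_iff, Fin.lt_def]
      rcases lt_trichotomy (i : ℕ) k with h | h | h
      · simp [h, h.ne', Nat.lt_succ_of_lt h]
      · simp [h]
      · simp [h.ne, h.not_gt, (Nat.succ_le_of_lt h).not_gt]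
    rw [hc, ih (Nat.le_of_succ_le hk), Finset.mul_sum,
      show g k = ∑ i : Fin L, if (⟨k, hk⟩ : Fin L) = i then g i else 0 by
        rw [Fintype.sum_ite_eq], ← Finset.sum_add_distrib]
    refine Finset.sum_congr rfl fun j _ => ?_
    rw [hprod]
    rcases lt_trichotomy (j : ℕ) k with h | h | h
    · simp [Fin.ext_iff, h, h.ne', Nat.lt_succ_of_lt h, mul_left_comm]
    · rw [Finset.prod_eq_one fun i _ => if_neg (by rw [Fin.lt_def]; omega)]
      simp [Fin.ext_iff, h]
    · simp [Fin.ext_iff, h.ne, h.not_gt, (Nat.succ_le_of_lt h).not_gt]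

theorem sum_testBit_mul (x : ℤ) (m B : ℕ) :
    ((List.range B).map fun s => if m.testBit s then x * 2 ^ s else 0).sum =
      x * (m % 2 ^ B : ℕ) := by
  induction B with
  | zero => simp [Nat.mod_one]
  | succ B ih =>
    rw [List.range_succ, List.map_append, List.sum_append, ih, Nat.mod_pow_succ]
    rcases Nat.mod_two_eq_zero_or_one (m / 2 ^ B) with h | h <;>
      simp [Nat.testBit_eq_decide_div_mod_eq, h, mul_add]

end TwosComplement

namespace NC

variable {P : Type} [Sized P] {A : P → Type*} {ι κ : P → Type} {x : ∀ p, A p → ι p → Bool}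
  [∀ p, Fintype (κ p)] {L : P → ℕ}

theorem intAdd (hκ : Poly fun p => Fintype.card (κ p)) (hL : Poly L) {u v : ∀ p, A p → κ p → ℤ}
    (hu : NC x fun p a (j : κ p × Fin (L p)) => (u p a j.1).testBit j.2)
    (hv : NC x fun p a (j : κ p × Fin (L p)) => (v p a j.1).testBit j.2) :
    NC x fun p a (j : κ p × Fin (L p)) => (u p a j.1 + v p a j.1).testBit j.2 := by
  have h1 := card_prod hκ (poly_fin hL)
  have h2 := card_prod h1 (poly_fin hL)
  have h3 := card_prod h2 (poly_fin hL)
  have hprod := prod h2 (poly_fin hL)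
    (ite (fun p (i : ((κ p × Fin (L p)) × Fin (L p)) × Fin (L p)) =>
        i.1.2 < i.2 ∧ (i.2 : ℕ) < i.1.1.2)
      (add h3 (hu.reindex fun p i => (i.1.1.1, i.2)) (hv.reindex fun p i => (i.1.1.1, i.2)))
      (one x))
  have hcarry := sum h1 (poly_fin hL)
    (ite (fun p (i : (κ p × Fin (L p)) × Fin (L p)) => (i.2 : ℕ) < i.1.2)
      (mul h2 (mul h2 (hu.reindex fun p i => (i.1.1, i.2)) (hv.reindex fun p i => (i.1.1, i.2)))
        hprod) (zero x))
  refine (add h1 (add h1 hu hv) hcarry).congr fun p a j => ?_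
  obtain ⟨c, h0, hc, hsum⟩ := exists_carry (u p a j.1) (v p a j.1)
  rw [hsum, carry_eq h0 hc j.2.2.le]

theorem intMulConst (hκ : Poly fun p => Fintype.card (κ p)) (hL : Poly L)
    {u : ∀ p, A p → κ p → ℤ} {B : P → ℕ} (hB : Poly B) (m : P → ℕ) (hm : ∀ p, m p < 2 ^ B p)
    (hu : NC x fun p a (j : κ p × Fin (L p)) => (u p a j.1).testBit j.2) :
    NC x fun p a (j : κ p × Fin (L p)) => (u p a j.1 * m p).testBit j.2 := by
  have := tree (e := fun p => Fin (L p)) (M := fun _ _ => ℤ) (fun _ _ z i => z.testBit i)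
    (fun _ _ z z' => z + z') (fun _ _ => 0) (fun _ _ => add_zero _) hB
    (fun p a k s => if s < B p then if (m p).testBit s then u p a k * 2 ^ s else 0 else 0)
    (fun p a k s hs => if_neg (not_lt.2 hs))
    (fun ι' x' u w hu hw => intAdd (L := fun q : P × ℕ => L q.1) (by
      simpa only [Fintype.card_prod, Fintype.card_fin] using
        (hκ.mul (hB.add (.const 1))).lift) hL.lift hu hw)
    ((ite (fun p (j : (κ p × Fin (B p + 1)) × Fin (L p)) =>
        (j.1.2 : ℕ) < B p ∧ (m p).testBit j.1.2 ∧ (j.1.2 : ℕ) ≤ j.2)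
      (hu.reindex fun p j => (j.1.1, ⟨j.2 - j.1.2, by have := j.2.2; omega⟩))
      (zero x)).congr fun p a j => by
        by_cases h1 : (j.1.2 : ℕ) < B p <;> by_cases h2 : (m p).testBit j.1.2 <;>
        by_cases h3 : (j.1.2 : ℕ) ≤ j.2 <;>
        simp [h1, h2, h3, testBit_mul_two_pow, testBit_zero, not_lt.2, not_le.1] <;> rfl)
  refine this.congr fun p a j => ?_
  rw [segment_add_eq_list_sum _ (Nat.le_pow_clog one_lt_two _), sum_testBit_mul,
    Nat.mod_eq_of_lt (hm p)]

end NC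

/-! ### The perturbed weights -/

/-- The parameters of the bit circuits. -/
structure Params (a : ℕ) where
  /-- the number of vertices -/
  n : ℕ
  /-- the perturbation range -/
  Wmax : ℕ
  /-- the truncation threshold -/
  d : ℕ
  /-- the bit length of the weights -/
  b : ℕ
  one_le_Wmax : 1 ≤ Wmax
  one_le_d : 1 ≤ d
  d_le : d ≤ (n + Wmax + 2) ^ a
  b_le : b ≤ (n + Wmax + 2) ^ a

namespace Params

variable {a : ℕ}

instance : Sized (Params a) where
  size p := p.n + p.Wmax + 2
  two_le_size _ := Nat.le_add_left 2 _

/-- The bit length of the perturbed weights. -/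
def len (p : Params a) : ℕ := tildeLen p.n p.Wmax p.b

theorem poly_n : Poly (Params.n (a := a)) := by
  exact PolyBounded.self.mono fun p => show p.n ≤ p.n + p.Wmax + 2 by omega

theorem poly_Wmax : Poly (Params.Wmax (a := a)) :=
  PolyBounded.self.mono fun p => show p.Wmax ≤ p.n + p.Wmax + 2 by omega

theorem poly_d : Poly (Params.d (a := a)) :=
  (PolyBounded.pow Sized.one_le_size .self a).mono d_le

theorem poly_b : Poly (Params.b (a := a)) :=
  (PolyBounded.pow Sized.one_le_size .self a).mono b_le

theorem size_le_self (m : ℕ) : Nat.size m ≤ m := Nat.size_le.2 Nat.lt_two_pow_self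

theorem poly_len : Poly (len (a := a)) :=
  poly_b.add (((poly_n.add (.const 1)).mul (poly_Wmax.add (.const 1))).mono
    fun _ => size_le_self _)

theorem poly_pairs : Poly fun p : Params a => Fintype.card (Fin p.n × Fin p.n) :=
  NC.card_prod (NC.poly_fin poly_n) (NC.poly_fin poly_n)

end Params

section Weights

variable {n : ℕ} (G : SimpleGraph (Fin n))

open Classical in
/-- Integers on the edges, extended by zero to all pairs of vertices. -/
def edgeInt (u : G.edgeSet → ℤ) (k : Fin n × Fin n) : ℤ :=
  if h : G.Adj k.1 k.2 then u ⟨s(k.1, k.2), h⟩ else 0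

theorem intBits_eq (len : ℕ) (u : G.edgeSet → ℤ) (j : (Fin n × Fin n) × Fin (len + 1)) :
    intBits G len u j = (edgeInt G u j.1).testBit j.2 := by
  rw [intBits, edgeInt]
  split_ifs
  · rfl
  · exact (testBit_zero _).symm

theorem natBits_eq (len : ℕ) (W : G.edgeSet → ℕ) (j : (Fin n × Fin n) × Fin len) :
    natBits G len W j = (edgeInt G (fun e => W e) j.1).testBit j.2 := by
  rw [natBits, edgeInt]
  split_ifs
  · rfl
  · exact (testBit_zero _).symm

variable {G} in
theorem edgeInt_mem {u : G.edgeSet → ℤ} {l r : ℤ} (h : ∀ e, l ≤ u e ∧ u e < r) (hl : l ≤ 0)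
    (hr : 0 < r) (k : Fin n × Fin n) : l ≤ edgeInt G u k ∧ edgeInt G u k < r := by
  rw [edgeInt]
  split_ifs
  · exact h _
  · exact ⟨hl, hr⟩

theorem edgeInt_tildeWeight (Wmax : ℕ) (w : G.edgeSet → ℤ) (W : G.edgeSet → ℕ)
    (k : Fin n × Fin n) : edgeInt G (tildeWeight G Wmax w W) k =
      edgeInt G w k * scale n Wmax + edgeInt G (fun e => W e) k := by
  simp only [edgeInt, tildeWeight]
  split_ifs <;> ring

theorem scale_mem (n : ℕ) {Wmax : ℕ} (h : 1 ≤ Wmax) :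
    1 ≤ scale n Wmax ∧ scale n Wmax + Wmax ≤ (n + 1) * (Wmax + 1) := by
  have h1 : (0 : ℤ) ≤ (Wmax : ℤ) - 1 := by omega
  have h2 : ((n / 2 : ℕ) : ℤ) ≤ n := by omega
  have h3 : (0 : ℤ) ≤ (n / 2 : ℕ) := by positivity
  rw [scale]
  constructor
  · nlinarith
  · nlinarith [mul_le_mul_of_nonneg_right h2 h1]

theorem tildeWeight_mem {Wmax b : ℕ} (hWmax : 1 ≤ Wmax) {w : G.edgeSet → ℤ} {W : G.edgeSet → ℕ}
    (hw : ∀ e, -2 ^ b ≤ w e ∧ w e < 2 ^ b) (hW : ∀ e, 1 ≤ W e ∧ W e ≤ Wmax) (e : G.edgeSet) :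
    -2 ^ tildeLen n Wmax b ≤ tildeWeight G Wmax w W e ∧
      tildeWeight G Wmax w W e < 2 ^ tildeLen n Wmax b := by
  obtain ⟨h1, h2⟩ := scale_mem n hWmax
  obtain ⟨hw1, hw2⟩ := hw e
  have hWe : (1 : ℤ) ≤ W e ∧ (W e : ℤ) ≤ Wmax := by exact_mod_cast hW e
  have hsize : ((n + 1) * (Wmax + 1) : ℤ) < 2 ^ Nat.size ((n + 1) * (Wmax + 1)) := by
    exact_mod_cast Nat.lt_size_self ((n + 1) * (Wmax + 1))
  have hb : (1 : ℤ) ≤ 2 ^ b := one_le_pow₀ one_le_two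
  rw [tildeLen, pow_add, tildeWeight]
  constructor <;> nlinarith

end Weights

/-- An input of the algorithm. -/
structure Input {a : ℕ} (p : Params a) where
  /-- the graph -/
  G : SimpleGraph (Fin p.n)
  /-- the weights -/
  w : G.edgeSet → ℤ
  /-- the perturbation -/
  W : G.edgeSet → ℕ
  w_mem : ∀ e, -2 ^ p.b ≤ w e ∧ w e < 2 ^ p.b
  W_mem : ∀ e, 1 ≤ W e ∧ W e ≤ p.Wmax

namespace Input

/-- The perturbed weights. -/
def weight {a : ℕ} {p : Params a} (i : Input p) : i.G.edgeSet → ℤ :=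
  tildeWeight i.G p.Wmax i.w i.W

/-- The bits of an input. -/
def encode {a : ℕ} (p : Params a) (i : Input p) :
    (Fin p.n × Fin p.n) ⊕ ((Fin p.n × Fin p.n) × Fin (p.b + 1)) ⊕
      ((Fin p.n × Fin p.n) × Fin (Nat.size p.Wmax)) → Bool :=
  inputBits i.G p.b p.Wmax i.w i.W

variable {a : ℕ}

theorem nc_intBits : NC (encode (a := a)) fun p i => intBits i.G p.len i.weight := by
  have hL := Params.poly_len (a := a).add (.const 1)
  have hw : NC (encode (a := a)) fun p i (j : (Fin p.n × Fin p.n) × Fin (p.len + 1)) =>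
      (edgeInt i.G i.w j.1).testBit j.2 := by
    refine (NC.input _ fun (p : Params a) (j : (Fin p.n × Fin p.n) × Fin (p.len + 1)) =>
      Sum.inr (Sum.inl (j.1, ⟨min (j.2 : ℕ) p.b, Nat.lt_succ_of_le (min_le_right _ _)⟩))).congr
      fun p i j => (intBits_eq _ _ _ _).trans ?_
    obtain ⟨h1, h2⟩ := edgeInt_mem i.w_mem (by simp) (by positivity) j.1
    rcases le_total (j.2 : ℕ) p.b with h | h
    · simp [h]
    · simp [h, testBit_of_le h1 h2 h, testBit_of_le h1 h2 le_rfl]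
  have hW : NC (encode (a := a)) fun p i (j : (Fin p.n × Fin p.n) × Fin (p.len + 1)) =>
      (edgeInt i.G (fun e => i.W e) j.1).testBit j.2 := by
    refine (NC.dite (fun (p : Params a) (j : (Fin p.n × Fin p.n) × Fin (p.len + 1)) =>
        (j.2 : ℕ) < Nat.size p.Wmax)
      (fun p j h => Sum.inr (Sum.inr (j.1, ⟨j.2, h⟩))) (NC.refl _) (NC.zero _)).congr
      fun p i j => ?_
    have hmem := edgeInt_mem (G := i.G) (u := fun e => i.W e) (l := 0) (r := 2 ^ Nat.size p.Wmax)
      (fun e => ⟨by positivity, by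
        exact_mod_cast (i.W_mem e).2.trans_lt (Nat.lt_size_self _)⟩) le_rfl (by positivity) j.1
    split_ifs with h
    · exact natBits_eq _ _ _ _
    · rw [testBit_of_le ((neg_nonpos.2 (by positivity)).trans hmem.1) hmem.2 (not_lt.1 h),
        decide_eq_false hmem.1.not_gt]
      rfl
  refine (NC.intAdd (u := fun p i k => edgeInt i.G i.w k * ((scale p.n p.Wmax).toNat : ℤ))
    (v := fun p i => edgeInt i.G fun e => i.W e) Params.poly_pairs hL (NC.intMulConst Params.poly_pairs hL
    (((Params.poly_n.add (.const 1)).mul (Params.poly_Wmax.add (.const 1))))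
    (fun p => (scale p.n p.Wmax).toNat) (fun p => ?_) hw) hW).congr fun p i j => ?_
  · have := scale_mem p.n p.one_le_Wmax
    have := p.one_le_Wmax
    refine lt_trans ?_ Nat.lt_two_pow_self
    zify
    rw [Int.toNat_of_nonneg (by omega)]
    linarith
  · rw [intBits_eq, weight, edgeInt_tildeWeight,
      Int.toNat_of_nonneg (zero_le_one.trans (scale_mem p.n p.one_le_Wmax).1)]

end Input

/-! ### Comparison of binary numbers and smallest exponents -/

section Bits

theorem prod_testBit {B m e : ℕ} (hm : m < 2 ^ B) (he : e < 2 ^ B) :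
    (∏ s : Fin B, if e.testBit s then m.testBit s else m.testBit s + 1) =
      if e = m then 1 else 0 := by
  have hfactor : ∀ s : Fin B, (if e.testBit s then m.testBit s else m.testBit s + 1) =
      if e.testBit s = m.testBit s then 1 else 0 := by
    intro s
    cases e.testBit s <;> cases m.testBit s <;> rfl
  rw [Finset.prod_congr rfl fun s _ => hfactor s]
  split_ifs with h
  · simp [h]
  · obtain ⟨s, hs⟩ := Nat.exists_testBit_ne_of_ne h
    have hsB : s < B := by
      by_contra! hB
      rw [Nat.testBit_lt_two_pow (he.trans_le (Nat.pow_le_pow_right two_pos hB)),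
        Nat.testBit_lt_two_pow (hm.trans_le (Nat.pow_le_pow_right two_pos hB))] at hs
      exact hs rfl
    exact Finset.prod_eq_zero (Finset.mem_univ ⟨s, hsB⟩) (if_neg hs)

namespace Trunc

variable {d : ℕ} (q : Trunc d)

theorem bit_eq_ite (k : Fin d) : q.bit k = if q.coeff k ≠ 0 then 1 else 0 := by
  have : ∀ c : ZMod 2, decide (c = 1) = if c ≠ 0 then 1 else 0 := by decide
  exact this _

theorem first_iff (k : ℕ) :
    (q.coeff k ≠ 0 ∧ ∀ i < k, q.coeff i = 0) ↔ q.coeff k ≠ 0 ∧ q.degMin = k := by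
  refine and_congr_right fun hk => ⟨fun h => ?_, fun h i hi => ?_⟩
  · refine le_antisymm (Nat.sInf_le hk) (not_lt.1 fun hlt => ?_)
    exact Nat.sInf_mem (s := {k | q.coeff k ≠ 0}) ⟨k, hk⟩ (h _ hlt)
  · exact not_not.1 (Nat.notMem_of_lt_sInf (s := {k | q.coeff k ≠ 0}) (hi.trans_eq h.symm))

theorem bit_mul_prod (k : Fin d) :
    q.bit k * ∏ i : Fin d, (if i < k then q.bit i + 1 else 1) =
      if q.coeff k ≠ 0 ∧ q.degMin = k then 1 else 0 := by
  have hfactor : ∀ i : Fin d, (if i < k then q.bit i + 1 else 1) =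
      if i < k ∧ q.coeff i ≠ 0 then 0 else 1 := by
    intro i
    rw [bit_eq_ite]
    by_cases hi : i < k <;> by_cases hc : q.coeff i = 0 <;> simp [hi, hc]
    rfl
  rw [Finset.prod_congr rfl fun i _ => hfactor i, bit_eq_ite]
  by_cases hk : q.coeff k = 0
  · simp [hk]
  simp only [← first_iff]
  by_cases h : ∀ i < (k : ℕ), q.coeff i = 0
  · rw [Finset.prod_eq_one, if_pos hk, if_pos ⟨hk, h⟩, one_mul]
    exact fun i _ => if_neg fun hi => hi.2 (h i hi.1)
  · rw [if_neg (fun h' => h (And.right h'))]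
    push Not at h
    obtain ⟨i, hik, hi⟩ := h
    have hprod : (∏ i : Fin d, if i < k ∧ q.coeff i ≠ 0 then (0 : Bool) else 1) = 0 :=
      Finset.prod_eq_zero (Finset.mem_univ (⟨i, hik.trans k.2⟩ : Fin d)) (if_pos ⟨hik, hi⟩)
    rw [hprod, mul_zero]

theorem degMin_lt (hd : 1 ≤ d) : q.degMin < d := by
  by_cases h : ∃ k, q.coeff k ≠ 0
  · exact not_le.1 fun hle => Nat.sInf_mem (s := {k | q.coeff k ≠ 0}) h (q.coeff_of_le hle)
  · rw [degMin, show {k | q.coeff k ≠ 0} = ∅ from Set.eq_empty_of_forall_notMem fun k hk => h ⟨k, hk⟩]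
    simpa using Nat.lt_of_succ_le hd

theorem sum_degMin {f : ℕ → Bool} (hf : f 0 = 0) :
    (∑ k : Fin d, (if q.coeff k ≠ 0 ∧ q.degMin = k then 1 else 0) * f k) = f q.degMin := by
  by_cases h : ∃ k, q.coeff k ≠ 0
  · have hmem : q.coeff q.degMin ≠ 0 := Nat.sInf_mem (s := {k | q.coeff k ≠ 0}) h
    have hlt : q.degMin < d := not_le.1 fun hle => hmem (q.coeff_of_le hle)
    rw [Finset.sum_eq_single (⟨q.degMin, hlt⟩ : Fin d)]
    · simp [hmem]
    · intro k _ hk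
      rw [if_neg fun h' => hk (Fin.ext h'.2.symm), zero_mul]
    · simp
  · push Not at h
    rw [degMin, show {k | q.coeff k ≠ 0} = ∅ from
      Set.eq_empty_of_forall_notMem fun k hk => hk (h k), Nat.sInf_empty, hf]
    simp [h]

end Trunc

end Bits

namespace NC

variable {P : Type} [Sized P] {A : P → Type*} {ι κ o : P → Type} {x : ∀ p, A p → ι p → Bool}
  [∀ p, Fintype (o p)] {d B : P → ℕ}

/-- Comparison with constants. -/
theorem eqConst (ho : Poly fun p => Fintype.card (o p)) (hB : Poly B) {m : ∀ p, A p → κ p → ℕ}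
    (hm : ∀ p a k, m p a k < 2 ^ B p)
    (h : NC x fun p a (j : κ p × Fin (B p)) => (m p a j.1).testBit j.2)
    (s : ∀ p, o p → κ p) (e : ∀ p, o p → ℕ) :
    NC x fun p a k => if e p k = m p a (s p k) then (1 : Bool) else 0 := by
  have h1 := card_prod ho (poly_fin hB)
  have hbit := h.reindex fun p (j : o p × Fin (B p)) => (s p j.1, j.2)
  refine (ite (fun p k => e p k < 2 ^ B p) (prod ho (poly_fin hB)
    (ite (fun p j => (e p j.1).testBit j.2 = true) hbit (add h1 hbit (one x)))) (zero x)).congr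
    fun p a k => ?_
  by_cases hk : e p k < 2 ^ B p
  · rw [if_pos hk, ← prod_testBit (hm p a (s p k)) hk]
  · rw [if_neg hk, if_neg fun h => hk (h.trans_lt (hm p a _))]

theorem isDegMin [∀ p, Fintype (κ p)] (hκ : Poly fun p => Fintype.card (κ p)) (hd : Poly d)
    {q : ∀ p, A p → κ p → Trunc (d p)} (h : NC x fun p a => bits (q p a)) :
    NC x fun p a (j : κ p × Fin (d p)) =>
      if (q p a j.1).coeff j.2 ≠ 0 ∧ (q p a j.1).degMin = j.2 then (1 : Bool) else 0 := by
  have h1 := card_prod hκ (poly_fin hd)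
  have h2 := card_prod h1 (poly_fin hd)
  refine (mul h1 h (prod h1 (poly_fin hd)
    (ite (fun p (i : (κ p × Fin (d p)) × Fin (d p)) => i.2 < i.1.2)
      (add h2 (h.reindex fun p i => (i.1.1, i.2)) (one x)) (one x)))).congr fun p a j => ?_
  exact (q p a j.1).bit_mul_prod j.2

end NC

/-! ### The remaining steps of the algorithm -/

/-- A graph with nonnegative weights of bounded bit length. -/
structure WeightedGraph {a : ℕ} (p : Params a) where
  /-- the graph -/
  G : SimpleGraph (Fin p.n)
  /-- the weights -/
  u : G.edgeSet → ℤ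
  u_mem : ∀ e, 0 ≤ u e ∧ u e < 2 ^ p.len

namespace WeightedGraph

variable {a : ℕ}

/-- The bits of a weighted graph. -/
def encode (p : Params a) (g : WeightedGraph p) :
    (Fin p.n × Fin p.n) ⊕ ((Fin p.n × Fin p.n) × Fin (p.len + 1)) → Bool :=
  Sum.elim (graphBits g.G) (intBits g.G p.len g.u)

theorem nc_tutte : NC (encode (a := a)) fun p g =>
    bits fun k : Fin p.n × Fin p.n => tutte g.G p.d g.u k.1 k.2 := by
  have hmem : ∀ (p : Params a) (g : WeightedGraph p) (k : Fin p.n × Fin p.n),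
      0 ≤ edgeInt g.G g.u k ∧ edgeInt g.G g.u k < 2 ^ p.len := fun p g k =>
    edgeInt_mem g.u_mem le_rfl (by positivity) k
  have ho := NC.card_prod Params.poly_pairs (NC.poly_fin (Params.poly_d (a := a)))
  refine (NC.mul ho (NC.input _ fun (p : Params a) (j : (Fin p.n × Fin p.n) × Fin p.d) => .inl j.1)
    (NC.eqConst ho (Params.poly_len.add (.const 1))
      (m := fun p g k => (edgeInt g.G g.u k).toNat) (fun p g k => ?_)
      ((NC.input _ fun (p : Params a) (j : (Fin p.n × Fin p.n) × Fin (p.len + 1)) => .inr j).congr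
        fun p g j => ?_)
      (fun p j => j.1) fun p j => j.2)).congr fun p g j => ?_
  · have := hmem p g k
    zify
    rw [Int.toNat_of_nonneg this.1, pow_succ]
    linarith
  · refine (intBits_eq _ _ _ _).trans ?_
    obtain ⟨m, hm⟩ := Int.eq_ofNat_of_zero_le (hmem p g j.1).1
    rw [hm]
    rfl
  · by_cases h : g.G.Adj j.1.1 j.1.2
    · simp only [encode, Sum.elim_inl, graphBits, bits, tutte, edgeInt, h, dite_true, decide_true,
        Trunc.bit_X_pow]
      exact one_mul _
    · simp only [encode, Sum.elim_inl, graphBits, bits, tutte, h, dite_false, decide_false,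
        Trunc.bit_zero]
      exact zero_mul _

end WeightedGraph

section MinWeight

variable {a : ℕ}

theorem minWeight_lt {d : ℕ} (hd : 1 ≤ d) (q : Trunc d) : minWeight q < 2 ^ Nat.size d :=
  ((Nat.div_le_self _ _).trans_lt (q.degMin_lt hd)).trans (Nat.lt_size_self d)

theorem nc_minWeight : NC (fun (p : Params a) (q : Trunc p.d) => bits fun _ : Unit => q)
    fun p q => numBits (Nat.size p.d) (minWeight q) := by
  have hU : Poly fun p : Params a => Fintype.card Unit := .const 1
  have hs : Poly fun p : Params a => Nat.size p.d := Params.poly_d.mono fun _ => Params.size_le_self _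
  have ho := NC.poly_fin hs
  refine (NC.sum ho (NC.poly_fin Params.poly_d) (NC.mul (NC.card_prod ho (NC.poly_fin Params.poly_d))
    ((NC.isDegMin hU Params.poly_d (q := fun p q _ => q) (NC.refl _)).reindex
      fun p (j : Fin (Nat.size p.d) × Fin p.d) => ((), j.2))
    (NC.ite (fun p j => ((j.2 : ℕ) / 2).testBit j.1 = true) (NC.one _) (NC.zero _)))).congr
    fun p q i => ?_
  refine (q.sum_degMin (f := fun k => if (k / 2).testBit i = true then 1 else 0) (by simp)).trans ?_
  rw [numBits, minWeight]
  cases (q.degMin / 2).testBit i <;> rfl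

end MinWeight

/-- The input of the last step of the algorithm. -/
structure SelectInput {a : ℕ} (p : Params a) extends WeightedGraph p where
  /-- the minors -/
  minor : Fin p.n × Fin p.n → Trunc p.d
  /-- the number `w*` -/
  ws : ℕ
  ws_lt : ws < 2 ^ Nat.size p.d

namespace SelectInput

variable {a : ℕ}

/-- The bits of the input of the last step. -/
def encode (p : Params a) (g : SelectInput p) :
    ((Fin p.n × Fin p.n) ⊕ ((Fin p.n × Fin p.n) × Fin (p.len + 1))) ⊕
      ((Fin p.n × Fin p.n) × Fin p.d) ⊕ Fin (Nat.size p.d) → Bool :=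
  Sum.elim (g.toWeightedGraph.encode p) (Sum.elim (bits g.minor) (numBits (Nat.size p.d) g.ws))

open Classical in
/-- Whether the edge between two vertices is selected in the given order of its ends. -/
def test {p : Params a} (g : SelectInput p) (k : Fin p.n × Fin p.n) : Bool :=
  graphBits g.G k *
    if (g.minor k * tutte g.G p.d g.u k.1 k.2).degMin = 2 * g.ws then 1 else 0

theorem test_eq_true_iff {p : Params a} (g : SelectInput p) (i j : Fin p.n) :
    g.test (i, j) = true ↔ ∃ h : g.G.Adj i j,
      (g.minor (i, j) * Trunc.X p.d ^ (g.u ⟨s(i, j), h⟩).toNat).degMin = 2 * g.ws := by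
  rw [test, graphBits, tutte]
  by_cases h : g.G.Adj i j <;> simp [h]

theorem nc_graphBits : NC (encode (a := a)) fun _ g => graphBits g.G :=
  NC.input encode fun _ k => Sum.inl (Sum.inl k)

theorem nc_tutte : NC (encode (a := a)) fun p g =>
    bits fun k : Fin p.n × Fin p.n => tutte g.G p.d g.u k.1 k.2 :=
  (NC.input encode fun _ j => Sum.inl j).trans (WeightedGraph.nc_tutte.comap fun _ (g : SelectInput _) => g.toWeightedGraph)

theorem nc_ws_eq {o : Params a → Type} [∀ p, Fintype (o p)] (ho : Poly fun p => Fintype.card (o p))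
    (e : ∀ p, o p → ℕ) :
    NC (encode (a := a)) fun p g k => if e p k = g.ws then (1 : Bool) else 0 :=
  NC.eqConst (κ := fun _ => Unit) (m := fun _ (g : SelectInput _) _ => g.ws) ho (Params.poly_d.mono fun _ => Params.size_le_self _)
    (fun _ g _ => g.ws_lt)
    (NC.input encode fun _ (j : Unit × Fin _) => Sum.inr (Sum.inr j.2)) (fun _ _ => ()) e

theorem nc_test : NC (encode (a := a)) fun _ g k => if g.ws = 0 then (0 : Bool) else g.test k := by
  have ho := Params.poly_pairs (a := a)
  have hd := NC.poly_fin (Params.poly_d (a := a))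
  have hod := NC.card_prod ho hd
  have hdeg := NC.isDegMin ho Params.poly_d (NC.truncMul (u := fun _ g => g.minor) ho
    Params.poly_d (NC.input encode fun (p : Params a) (j : (Fin p.n × Fin p.n) × Fin p.d) =>
      Sum.inr (Sum.inl j)) nc_tutte)
  refine (NC.mul ho (NC.add ho (nc_ws_eq ho fun _ _ => 0) (NC.one _))
    (NC.mul ho nc_graphBits (NC.sum ho hd (NC.mul hod hdeg
      (NC.ite (fun (p : Params a) (j : (Fin p.n × Fin p.n) × Fin p.d) => Even (j.2 : ℕ))
        (nc_ws_eq hod fun p j => (j.2 : ℕ) / 2) (NC.zero _)))))).congr fun p g k => ?_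
  by_cases hws : g.ws = 0
  · rw [if_pos hws, if_pos hws.symm]
    exact zero_mul _
  · rw [if_neg hws, if_neg (Ne.symm hws), zero_add, one_mul, test]
    congr 1
    refine (Trunc.sum_degMin (g.minor k * tutte g.G p.d g.u k.1 k.2)
      (f := fun e => if Even e then if e / 2 = g.ws then 1 else 0 else 0)
      (by simp [Ne.symm hws])).trans ?_
    generalize (g.minor k * tutte g.G p.d g.u k.1 k.2).degMin = m
    rw [← ite_and]
    exact if_congr (by grind) rfl rfl

theorem outputBits_some_some {n : ℕ} (M : Set (Sym2 (Fin n))) (k : Fin n × Fin n) :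
    outputBits (some M) (some k) = true ↔ s(k.1, k.2) ∈ M := by
  simp [outputBits]

theorem nc_select : NC (encode (a := a)) fun _ g => outputBits (select g.G g.u g.minor g.ws) := by
  have ho := Params.poly_pairs (a := a)
  have hswap := nc_test (a := a).reindex fun _ (k : Fin _ × Fin _) => k.swap
  refine (((nc_ws_eq (o := fun _ => Unit) (.const 1) fun _ _ => 0).pair
    (NC.add ho (NC.add ho nc_test hswap) (NC.mul ho nc_test hswap))).reindex
    fun p (k : Option (Fin p.n × Fin p.n)) => k.elim (.inl ()) .inr).congr fun p g k => ?_
  by_cases hws : g.ws = 0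
  · rcases k with _ | k <;> simp [select, outputBits, hws] <;> rfl
  · rcases k with _ | ⟨i, j⟩
    · simp [select, outputBits, hws, Ne.symm hws]
      rfl
    · simp only [Option.elim_some, Sum.elim_inr, select, hws, if_false, Prod.swap_prod_mk]
      have hor : ∀ s t : Bool, s + t + s * t = (s || t) := by decide
      rw [hor, Bool.eq_iff_iff, Bool.or_eq_true, test_eq_true_iff, test_eq_true_iff,
        outputBits_some_some, Set.mem_ofPred_eq]
      constructor
      · rintro (⟨h, e⟩ | ⟨h, e⟩)
        · exact ⟨i, j, h, rfl, e⟩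
        · exact ⟨j, i, h, Sym2.eq_swap, e⟩
      · rintro ⟨i', j', h, hs, e⟩
        rcases Sym2.eq_iff.1 hs with ⟨rfl, rfl⟩ | ⟨rfl, rfl⟩
        · exact .inl ⟨h, e⟩
        · exact .inr ⟨h, e⟩

end SelectInput

/-! ### The whole algorithm -/

theorem Circuit.Polylog.mono_size {ι o : Type} {C : Circuit ι o} {c N N' : ℕ} (h : C.Polylog c N)
    (hN : N ≤ N') : C.Polylog c N' :=
  ⟨h.1.trans (Nat.mul_le_mul_left _ (Nat.pow_le_pow_left (Nat.log_mono_right hN) _)),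
    h.2.trans (Nat.mul_le_mul_left _ (Nat.pow_le_pow_left hN _))⟩

theorem NC.of_realizes {P : Type} [Sized P] {ι o : P → Type} {d : P → ℕ}
    {C : ∀ p, Circuit (ι p) (o p)} {c : ℕ}
    (h : ∀ p, ∃ Q : Circuit (ι p × Fin (d p)) (o p × Fin (d p)),
      Q.Polylog c (Sized.size p) ∧ Realizes (d p) Q (C p)) :
    NC (fun p (x : ι p → Trunc (d p)) => bits x) fun p x => bits ((C p).eval x) :=
  .of_polylog fun p => (h p).imp fun _ hQ => ⟨hQ.1, fun x => (hQ.2.choose_spec x).2⟩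

theorem eval_phases {ι κ : Type} {m : ℕ} {P₁ : Circuit ι (κ × Fin m × Fin (m + 1))}
    {P₂ : Circuit (κ × Fin m × Fin (m + 1)) κ} {sub : κ → Fin m → Fin m → ι}
    (h₁ : ExecutesPhase₁ P₁ sub) (h₂ : ExecutesPhase₂ P₂) {R : Type} [CommRing R] (x : ι → R) :
    P₂.eval (P₁.eval x) = fun k => (Matrix.of fun r c => x (sub k r c)).det := by
  funext k
  rw [h₂ R, ← sbDet_eq_det, sbDet]
  congr 1
  funext t j
  exact h₁ R x k t j

section Decoder

variable {a : ℕ}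

/-- An input with nonnegative perturbed weights. -/
abbrev NonnegInput (p : Params a) : Type := {i : Input p // ∀ e, 0 ≤ i.weight e}

/-- The graph with the perturbed weights. -/
def NonnegInput.graph {p : Params a} (i : NonnegInput p) : WeightedGraph p where
  G := i.1.G
  u := i.1.weight
  u_mem e := ⟨i.2 e, (tildeWeight_mem i.1.G p.one_le_Wmax i.1.w_mem i.1.W_mem e).2⟩

/-- The matrix for the perturbed weights. -/
def NonnegInput.matrix {p : Params a} (i : NonnegInput p) : Matrix (Fin p.n) (Fin p.n) (Trunc p.d) :=
  tutte i.1.G p.d i.1.weight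

/-- The data for the last step. -/
def NonnegInput.selectInput {p : Params a} (i : NonnegInput p) : SelectInput p where
  toWeightedGraph := i.graph
  minor k := (removed i.matrix k.1 k.2).det
  ws := minWeight i.matrix.det
  ws_lt := minWeight_lt p.one_le_d _

theorem nc_decoder {D₁ : ∀ n, Circuit (Fin n × Fin n) (Unit × Fin n × Fin (n + 1))}
    {D₂ : ∀ n, Circuit (Unit × Fin n × Fin (n + 1)) Unit}
    {M₁ : ∀ n, Circuit (Fin n × Fin n) ((Fin n × Fin n) × Fin (n - 1) × Fin (n - 1 + 1))}
    {M₂ : ∀ n, Circuit ((Fin n × Fin n) × Fin (n - 1) × Fin (n - 1 + 1)) (Fin n × Fin n)}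
    (hD₁ : ∀ n, ExecutesPhase₁ (D₁ n) fun _ r s => (r, s)) (hD₂ : ∀ n, ExecutesPhase₂ (D₂ n))
    (hM₁ : ∀ n, ExecutesPhase₁ (M₁ n) fun k r s => (skip k.1 r, skip k.2 s))
    (hM₂ : ∀ n, ExecutesPhase₂ (M₂ n))
    (rD₁ : NC (fun (p : Params a) (x : _ → Trunc p.d) => bits x) fun p x => bits ((D₁ p.n).eval x))
    (rD₂ : NC (fun (p : Params a) (x : _ → Trunc p.d) => bits x) fun p x => bits ((D₂ p.n).eval x))
    (rM₁ : NC (fun (p : Params a) (x : _ → Trunc p.d) => bits x) fun p x => bits ((M₁ p.n).eval x))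
    (rM₂ : NC (fun (p : Params a) (x : _ → Trunc p.d) => bits x) fun p x => bits ((M₂ p.n).eval x)) :
    NC (fun (p : Params a) (i : NonnegInput p) => i.1.encode p) fun p i =>
      outputBits (decoder i.1.G p.d p.Wmax i.1.w i.1.W) := by
  have hgraph : NC (fun (p : Params a) (i : NonnegInput p) => i.1.encode p)
      fun p i => i.graph.encode p :=
    (NC.input _ fun _ k => Sum.inl k).pair (Input.nc_intBits.comap fun _ (i : NonnegInput _) => i.1)
  have hmatrix := hgraph.trans (WeightedGraph.nc_tutte.comap fun _ (i : NonnegInput _) => i.graph)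
  have hdet : NC (fun (p : Params a) (i : NonnegInput p) => i.1.encode p)
      fun p i => bits fun _ : Unit => i.matrix.det := by
    refine (hmatrix.trans ((rD₁.trans (rD₂.comap fun p x => (D₁ p.n).eval x)).comap
      fun p (i : NonnegInput p) (k : Fin p.n × Fin p.n) => i.matrix k.1 k.2)).congr fun p i j => ?_
    rw [eval_phases (hD₁ p.n) (hD₂ p.n)]
    rfl
  have hminor : NC (fun (p : Params a) (i : NonnegInput p) => i.1.encode p)
      fun p i => bits i.selectInput.minor := by
    refine (hmatrix.trans ((rM₁.trans (rM₂.comap fun p x => (M₁ p.n).eval x)).comap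
      fun p (i : NonnegInput p) (k : Fin p.n × Fin p.n) => i.matrix k.1 k.2)).congr fun p i j => ?_
    rw [eval_phases (hM₁ p.n) (hM₂ p.n)]
    rfl
  have hws := hdet.trans (nc_minWeight.comap fun p (i : NonnegInput p) => i.matrix.det)
  exact (hgraph.pair (hminor.pair hws)).trans
    (SelectInput.nc_select.comap fun p (i : NonnegInput p) => i.selectInput)

end Decoder

end MWPM

end

open MWPM in
theorem theorem2 (a : ℕ) :
    -- the Samuelson-Berkowitz algorithm computes determinants over every commutative ring
    (∀ (R : Type) [CommRing R] (m : ℕ) (A : Matrix (Fin m) (Fin m) R), sbDet A = A.det) ∧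
    ∃ c : ℕ, ∀ n : ℕ,
      -- division-free arithmetic circuits for the Samuelson-Berkowitz algorithm,
      -- on an `n × n` matrix and on all its submatrices without one row and one column
      ∃ (D₁ : Circuit (Fin n × Fin n) (Unit × Fin n × Fin (n + 1)))
        (D₂ : Circuit (Unit × Fin n × Fin (n + 1)) Unit)
        (M₁ : Circuit (Fin n × Fin n) ((Fin n × Fin n) × Fin (n - 1) × Fin (n - 1 + 1)))
        (M₂ : Circuit ((Fin n × Fin n) × Fin (n - 1) × Fin (n - 1 + 1)) (Fin n × Fin n)),
        ExecutesPhase₁ D₁ (fun _ r s => (r, s)) ∧ D₁.Polylog c (n + 2) ∧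
        ExecutesPhase₂ D₂ ∧ D₂.Polylog c (n + 2) ∧
        ExecutesPhase₁ M₁ (fun k r s => (skip k.1 r, skip k.2 s)) ∧ M₁.Polylog c (n + 2) ∧
        ExecutesPhase₂ M₂ ∧ M₂.Polylog c (n + 2) ∧
        -- bit circuits for the steps of the algorithm
        ∀ Wmax d b : ℕ, Even n → 1 ≤ Wmax → 1 ≤ d →
          d ≤ (n + Wmax + 2) ^ a → b ≤ (n + Wmax + 2) ^ a →
          -- step 1: the perturbed weights
          (∃ Q : Circuit ((Fin n × Fin n) ⊕ ((Fin n × Fin n) × Fin (b + 1)) ⊕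
                ((Fin n × Fin n) × Fin (Nat.size Wmax)))
              ((Fin n × Fin n) × Fin (tildeLen n Wmax b + 1)),
            Q.Polylog c (n + Wmax + 2) ∧
            ∀ (G : SimpleGraph (Fin n)) (w : G.edgeSet → ℤ) (W : G.edgeSet → ℕ),
              (∀ e, -2 ^ b ≤ w e ∧ w e < 2 ^ b) → (∀ e, 1 ≤ W e ∧ W e ≤ Wmax) →
              (∀ e, -2 ^ tildeLen n Wmax b ≤ tildeWeight G Wmax w W e ∧
                tildeWeight G Wmax w W e < 2 ^ tildeLen n Wmax b) ∧
              Q.eval (inputBits G b Wmax w W) =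
                intBits G (tildeLen n Wmax b) (tildeWeight G Wmax w W)) ∧
          -- step 2: the matrix
          (∃ Q : Circuit ((Fin n × Fin n) ⊕ ((Fin n × Fin n) × Fin (tildeLen n Wmax b + 1)))
              ((Fin n × Fin n) × Fin d),
            Q.Polylog c (n + Wmax + 2) ∧
            ∀ (G : SimpleGraph (Fin n)) (u : G.edgeSet → ℤ),
              (∀ e, 0 ≤ u e ∧ u e < 2 ^ tildeLen n Wmax b) →
              Q.eval (Sum.elim (graphBits G) (intBits G (tildeLen n Wmax b) u)) =
                bits (fun p : Fin n × Fin n => tutte G d u p.1 p.2)) ∧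
          -- step 3: the determinant by the two phases of the Samuelson-Berkowitz algorithm
          (∃ Q : Circuit ((Fin n × Fin n) × Fin d) ((Unit × Fin n × Fin (n + 1)) × Fin d),
            Q.Polylog c (n + Wmax + 2) ∧ Realizes d Q D₁) ∧
          (∃ Q : Circuit ((Unit × Fin n × Fin (n + 1)) × Fin d) (Unit × Fin d),
            Q.Polylog c (n + Wmax + 2) ∧ Realizes d Q D₂) ∧
          -- step 3: the number `w*` from the determinant
          (∃ Q : Circuit (Unit × Fin d) (Fin (Nat.size d)),
            Q.Polylog c (n + Wmax + 2) ∧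
            ∀ p : Trunc d, minWeight p < 2 ^ Nat.size d ∧
              Q.eval (bits (fun _ : Unit => p)) = numBits (Nat.size d) (minWeight p)) ∧
          -- step 4: all minors by the two phases of the Samuelson-Berkowitz algorithm
          (∃ Q : Circuit ((Fin n × Fin n) × Fin d)
              (((Fin n × Fin n) × Fin (n - 1) × Fin (n - 1 + 1)) × Fin d),
            Q.Polylog c (n + Wmax + 2) ∧ Realizes d Q M₁) ∧
          (∃ Q : Circuit (((Fin n × Fin n) × Fin (n - 1) × Fin (n - 1 + 1)) × Fin d)
              ((Fin n × Fin n) × Fin d),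
            Q.Polylog c (n + Wmax + 2) ∧ Realizes d Q M₂) ∧
          -- step 4: the output from the weights, the minors and `w*`
          (∃ Q : Circuit (((Fin n × Fin n) ⊕ ((Fin n × Fin n) × Fin (tildeLen n Wmax b + 1))) ⊕
                ((Fin n × Fin n) × Fin d) ⊕ Fin (Nat.size d)) (Option (Fin n × Fin n)),
            Q.Polylog c (n + Wmax + 2) ∧
            ∀ (G : SimpleGraph (Fin n)) (u : G.edgeSet → ℤ) (minor : Fin n × Fin n → Trunc d)
              (ws : ℕ), (∀ e, 0 ≤ u e ∧ u e < 2 ^ tildeLen n Wmax b) → ws < 2 ^ Nat.size d →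
              Q.eval (Sum.elim (Sum.elim (graphBits G) (intBits G (tildeLen n Wmax b) u))
                  (Sum.elim (bits minor) (numBits (Nat.size d) ws))) =
                outputBits (select G u minor ws)) ∧
          -- the whole algorithm
          (∃ Q : Circuit ((Fin n × Fin n) ⊕ ((Fin n × Fin n) × Fin (b + 1)) ⊕
                ((Fin n × Fin n) × Fin (Nat.size Wmax))) (Option (Fin n × Fin n)),
            Q.Polylog c (n + Wmax + 2) ∧
            ∀ (G : SimpleGraph (Fin n)) (w : G.edgeSet → ℤ) (W : G.edgeSet → ℕ),
              (∀ e, -2 ^ b ≤ w e ∧ w e < 2 ^ b) → (∀ e, 1 ≤ W e ∧ W e ≤ Wmax) →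
              (∀ e, 0 ≤ tildeWeight G Wmax w W e) →
              Q.eval (inputBits G b Wmax w W) = outputBits (decoder G d Wmax w W)) := by
  refine ⟨fun R _ m A => sbDet_eq_det A, ?_⟩
  have hn : PolyBounded (fun n => n + 2) fun n : ℕ => n :=
    PolyBounded.self.mono fun n => Nat.le_add_right n 2
  have hU : PolyBounded (fun n => n + 2) fun n : ℕ => Fintype.card Unit :=
    .const (fun _ => by omega) 1
  have hp : PolyBounded (fun n => n + 2) fun n : ℕ => Fintype.card (Fin n × Fin n) := by
    simpa using PolyBounded.mul (fun _ => by omega) hn hn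
  obtain ⟨c₁, h₁⟩ := exists_phase₁ (ι := fun n => Fin n × Fin n) hU hn fun _ _ r s => (r, s)
  obtain ⟨c₂, h₂⟩ := exists_phase₂ hU hn
  obtain ⟨c₃, h₃⟩ := exists_phase₁ hp (hn.mono fun n => Nat.sub_le n 1)
    fun _ k r s => (skip k.1 r, skip k.2 s)
  obtain ⟨c₄, h₄⟩ := exists_phase₂ hp (hn.mono fun n => Nat.sub_le n 1)
  choose D₁ pD₁ hD₁ using h₁
  choose D₂ pD₂ hD₂ using h₂
  choose M₁ pM₁ hM₁ using h₃
  choose M₂ pM₂ hM₂ using h₄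
  have hle : ∀ p : Params a, p.n + 2 ≤ Sized.size p := fun p =>
    show p.n + 2 ≤ p.n + p.Wmax + 2 by omega
  obtain ⟨c₅, h₅⟩ := exists_realizes _ (fun p : Params a => (pD₁ p.n).mono_size (hle p))
    Params.poly_d
  obtain ⟨c₆, h₆⟩ := exists_realizes _ (fun p : Params a => (pD₂ p.n).mono_size (hle p))
    Params.poly_d
  obtain ⟨c₇, h₇⟩ := exists_realizes _ (fun p : Params a => (pM₁ p.n).mono_size (hle p))
    Params.poly_d
  obtain ⟨c₈, h₈⟩ := exists_realizes _ (fun p : Params a => (pM₂ p.n).mono_size (hle p))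
    Params.poly_d
  obtain ⟨c₉, h₉⟩ := (Input.nc_intBits (a := a)).exists_polylog
  obtain ⟨c₁₀, h₁₀⟩ := (WeightedGraph.nc_tutte (a := a)).exists_polylog
  obtain ⟨c₁₁, h₁₁⟩ := (nc_minWeight (a := a)).exists_polylog
  obtain ⟨c₁₂, h₁₂⟩ := (SelectInput.nc_select (a := a)).exists_polylog
  obtain ⟨c₁₃, h₁₃⟩ := (nc_decoder hD₁ hD₂ hM₁ hM₂ (.of_realizes h₅) (.of_realizes h₆)
    (.of_realizes h₇) (.of_realizes h₈)).exists_polylog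
  refine ⟨c₁ + c₂ + c₃ + c₄ + c₅ + c₆ + c₇ + c₈ + c₉ + c₁₀ + c₁₁ + c₁₂ + c₁₃, fun n =>
    ⟨D₁ n, D₂ n, M₁ n, M₂ n, hD₁ n, (pD₁ n).mono (by omega) (by omega), hD₂ n,
      (pD₂ n).mono (by omega) (by omega), hM₁ n, (pM₁ n).mono (by omega) (by omega), hM₂ n,
      (pM₂ n).mono (by omega) (by omega), fun Wmax d b _ hW hd hda hba => ?_⟩⟩
  let p : Params a := ⟨n, Wmax, d, b, hW, hd, hda, hba⟩
  have hN : 2 ≤ n + Wmax + 2 := by omega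
  refine ⟨?_, ?_, ?_, ?_, ?_, ?_, ?_, ?_, ?_⟩
  · obtain ⟨Q, hQ, hQ'⟩ := h₉ p
    exact ⟨Q, hQ.mono hN (by omega), fun G w W hw hW' =>
      ⟨tildeWeight_mem G hW hw hW', hQ' ⟨G, w, W, hw, hW'⟩⟩⟩
  · obtain ⟨Q, hQ, hQ'⟩ := h₁₀ p
    exact ⟨Q, hQ.mono hN (by omega), fun G u hu => hQ' ⟨G, u, hu⟩⟩
  · obtain ⟨Q, hQ, hQ'⟩ := h₅ p
    exact ⟨Q, hQ.mono hN (by omega), hQ'⟩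
  · obtain ⟨Q, hQ, hQ'⟩ := h₆ p
    exact ⟨Q, hQ.mono hN (by omega), hQ'⟩
  · obtain ⟨Q, hQ, hQ'⟩ := h₁₁ p
    exact ⟨Q, hQ.mono hN (by omega), fun q => ⟨minWeight_lt hd q, hQ' q⟩⟩
  · obtain ⟨Q, hQ, hQ'⟩ := h₇ p
    exact ⟨Q, hQ.mono hN (by omega), hQ'⟩
  · obtain ⟨Q, hQ, hQ'⟩ := h₈ p
    exact ⟨Q, hQ.mono hN (by omega), hQ'⟩
  · obtain ⟨Q, hQ, hQ'⟩ := h₁₂ p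
    exact ⟨Q, hQ.mono hN (by omega), fun G u minor ws hu hws =>
      hQ' ⟨⟨G, u, hu⟩, minor, ws, hws⟩⟩
  · obtain ⟨Q, hQ, hQ'⟩ := h₁₃ p
    exact ⟨Q, hQ.mono hN (by omega), fun G w W hw hW' h0 => hQ' ⟨⟨G, w, W, hw, hW'⟩, h0⟩⟩
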